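/- Zimin words are defined by $Z_0=\lambda$ (the empty word) and $Z_{k+1}=Z_k\,x_{k+1}\,Z_k$, where $x_1,x_2,\dots$ are distinct variables. The Zimin type of a finite word $w$ is the largest $k$ such that $w=h(Z_k)$ for some non-erasing morphism $h$. Let $F_{-1}=b$, $F_0=a$, $F_n=F_{n-1}F_{n-2}$ be the Fibonacci words, let $F_\infty$ be the infinite word that has all $F_n$, $n\ge 0$, as prefixes, and let $\mathsf{ZFib}[n]$ be the Zimin type of the prefix $F_\infty[1..n]$ of length $n$. For $n\ge1$ consider a random access machine with a fixed finite number of registers and with memory cells numbered $0,1,2,\dots$, where every register and every cell holds a natural number not exceeding $n$. In one unit of time it can load a constant into a register, copy, add or subtract the contents of registers (the result has to be a number in $\{0,\dots,n\}$; otherwise the machine is stuck and computes nothing), load or store a memory cell whose address is held in a register, jump, or jump conditionally on the comparison of two registers. At the start, one register contains $n$, and all other registers and all cells contain $0$. Space is measured in bits: every register, and every memory cell from cell $0$ up to the largest address accessed so far, takes the length of the binary notation of its contents (one bit for $0$). (1) There is a program, not depending on $n$, that for each $n\ge1$ computes $\mathsf{ZFib}[n]$ on this machine in $O(\log n)$ time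 and $O(\log n)$ space. (2) There is a program, not depending on $n$, that for each $n\ge1$ computes on this machine the whole array $\mathsf{ZFib}[1],\dots,\mathsf{ZFib}[n]$ in time $O(n\log\log n/\log n)$. Here the array is output in packed form: the program halts with three numbers $A$, $m\ge1$, $w$ in designated registers such that for $0\le i<n$ the value $\mathsf{ZFib}[i+1]$ equals $\lfloor M[A+\lfloor i/m\rfloor]/2^{w\cdot(i \bmod m)}\rfloor \bmod 2^{w}$, where $M[j]$ is the content of the memory cell $j$; that is, each cell holds $m$ consecutive elements in fields of $w$ bits. -/

import Mathlib

/-! ### Zimin words and Zimin type -/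

/-- The Zimin word of rank `k` over the variables `1, 2, 3, …`:
`Z₀` is empty and `Z_{k+1} = Z_k · x_{k+1} · Z_k`. -/
def ziminWord : ℕ → List ℕ
  | 0 => []
  | k + 1 => ziminWord k ++ [k + 1] ++ ziminWord k

/-- `w` is the image of the Zimin word of rank `k` under a non-erasing morphism. -/
def IsZiminImage {α : Type*} (k : ℕ) (w : List α) : Prop :=
  ∃ h : ℕ → List α, (∀ x ∈ ziminWord k, h x ≠ []) ∧ (ziminWord k).flatMap h = w

/-- The Zimin type of a word: the largest `k` such that the word is the image of the Zimin word
of rank `k` under a non-erasing morphism (it is a maximum by `ziminType_isGreatest`). -/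
noncomputable def ziminType {α : Type*} (w : List α) : ℕ :=
  sSup {k : ℕ | IsZiminImage k w}

theorem le_length_ziminWord (k : ℕ) : k ≤ (ziminWord k).length := by
  induction k with
  | zero => simp
  | succ k ih => simp only [ziminWord, List.length_append, List.length_singleton]; omega

theorem IsZiminImage.le_length {α : Type*} {k : ℕ} {w : List α} (hw : IsZiminImage k w) :
    k ≤ w.length := by
  obtain ⟨h, hne, rfl⟩ := hw
  have key : ∀ l : List ℕ, (∀ x ∈ l, h x ≠ []) → l.length ≤ (l.flatMap h).length := by
    intro l
    induction l with
    | nil => simp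
    | cons a l ih =>
      intro hl
      have h1 := ih fun x hx => hl x (List.mem_cons_of_mem _ hx)
      have h2 : 0 < (h a).length := List.length_pos_of_ne_nil (hl a List.mem_cons_self)
      simp only [List.flatMap_cons, List.length_append, List.length_cons]
      omega
  exact (le_length_ziminWord k).trans (key _ hne)

theorem ziminType_isGreatest {α : Type*} (w : List α) :
    IsGreatest {k : ℕ | IsZiminImage k w} (ziminType w) := by
  have hb : BddAbove {k : ℕ | IsZiminImage k w} := ⟨w.length, fun k hk => hk.le_length⟩
  have hn : {k : ℕ | IsZiminImage k w}.Nonempty := by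
    by_cases hw : w = []
    · exact ⟨0, fun _ => [], by simp [ziminWord], by simp [ziminWord, hw]⟩
    · exact ⟨1, fun _ => w, by simp [hw], by simp [ziminWord]⟩
  exact ⟨Nat.sSup_mem hn hb, fun k hk => le_csSup hb hk⟩

/-! ### The infinite Fibonacci word -/

/-- The two-letter alphabet of the Fibonacci words. -/
inductive FibLetter
  | a
  | b
  deriving DecidableEq

/-- The Fibonacci words with the index shifted by one: `fibWord (n + 1)` is `F_n`, where
`F_{-1} = b`, `F_0 = a`, `F_n = F_{n-1} F_{n-2}`. -/
def fibWord : ℕ → List FibLetter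
  | 0 => [FibLetter.b]
  | 1 => [FibLetter.a]
  | n + 2 => fibWord (n + 1) ++ fibWord n

theorem lt_length_fibWord : ∀ i : ℕ, i < (fibWord (i + 1)).length
  | 0 => by simp [fibWord]
  | 1 => by simp [fibWord]
  | i + 2 => by
    have h1 := lt_length_fibWord (i + 1)
    have h2 := lt_length_fibWord i
    have h3 : (fibWord (i + 2 + 1)).length
        = (fibWord (i + 1 + 1)).length + (fibWord (i + 1)).length := by
      rw [fibWord, List.length_append]
    omega

/-- The letters of the infinite Fibonacci word `F_∞`, numbered from `0`. Since every `F_n` with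
`n ≥ 0` is a prefix of `F_∞`, its letter number `i` can be read off from `F_i`. -/
def fibInfinite (i : ℕ) : FibLetter :=
  (fibWord (i + 1))[i]'(lt_length_fibWord i)

theorem fibWord_prefix {m n : ℕ} (h : m ≤ n) : fibWord (m + 1) <+: fibWord (n + 1) := by
  induction n, h using Nat.le_induction with
  | base => exact List.prefix_rfl
  | succ n _ ih => exact ih.trans (by rw [fibWord]; exact List.prefix_append _ _)

/-- `fibInfinite` is the infinite word that has all `F_n`, `n ≥ 0`, as prefixes. -/
theorem fibInfinite_eq_getElem (n i : ℕ) (hi : i < (fibWord (n + 1)).length) :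
    fibInfinite i = (fibWord (n + 1))[i] := by
  unfold fibInfinite
  rcases le_total i n with h | h
  · exact (fibWord_prefix h).getElem _
  · exact ((fibWord_prefix h).getElem hi).symm

/-- The prefix `F_∞[1..n]` of length `n`. -/
def fibPrefix (n : ℕ) : List FibLetter :=
  List.ofFn fun i : Fin n => fibInfinite i

/-- `ZFib[n]`, the Zimin type of `F_∞[1..n]`. -/
noncomputable def zFib (n : ℕ) : ℕ :=
  ziminType (fibPrefix n)

/-! ### A random access machine on numbers up to a given capacity

The machine has `k` registers and a memory whose cells are numbered `0, 1, 2, …`. Registers and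
cells hold natural numbers that do not exceed the capacity of the machine. Each instruction takes
one unit of time; the only operations on numbers are copying, addition, subtraction and
comparison. -/

/-- The instructions of a machine with `k` registers. -/
inductive Instr (k : ℕ)
  /-- `R[d] := c` -/
  | const (d : Fin k) (c : ℕ)
  /-- `R[d] := R[s]` -/
  | copy (d s : Fin k)
  /-- `R[d] := R[x] + R[y]` -/
  | add (d x y : Fin k)
  /-- `R[d] := R[x] - R[y]` -/
  | sub (d x y : Fin k)
  /-- `R[d] := M[R[x]]` -/
  | load (d x : Fin k)
  /-- `M[R[x]] := R[s]` -/
  | store (x s : Fin k)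
  /-- go to instruction number `l` -/
  | jump (l : ℕ)
  /-- go to instruction number `l` if `R[x] < R[y]` -/
  | jumpLt (x y : Fin k) (l : ℕ)

/-- A program is a finite list of instructions, numbered from `0`. -/
abbrev Program (k : ℕ) := List (Instr k)

/-- A configuration of a machine with `k` registers. -/
@[ext]
structure Config (k : ℕ) where
  /-- the number of the next instruction -/
  pc : ℕ
  /-- the contents of the registers -/
  reg : Fin k → ℕ
  /-- the contents of the memory -/
  mem : ℕ → ℕ
  /-- all the memory cells accessed so far have addresses below `used` -/
  used : ℕ

namespace Config

variable {k : ℕ}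

/-- Write the number `v` to the register `d` and go on to the next instruction. This is possible
only if `v` does not exceed the capacity `cap`. -/
def write (cap : ℕ) (c : Config k) (d : Fin k) (v : ℕ) : Option (Config k) :=
  if v ≤ cap then some { c with pc := c.pc + 1, reg := Function.update c.reg d v } else none

/-- Execute one instruction on a machine of capacity `cap`. There is no result (the machine is
stuck) if the instruction would produce a number that is negative or greater than `cap`. -/
def exec (cap : ℕ) (c : Config k) : Instr k → Option (Config k)
  | .const d v => c.write cap d v
  | .copy d s => c.write cap d (c.reg s)
  | .add d x y => c.write cap d (c.reg x + c.reg y)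
  | .sub d x y => if c.reg y ≤ c.reg x then c.write cap d (c.reg x - c.reg y) else none
  | .load d x => { c with used := max c.used (c.reg x + 1) }.write cap d (c.mem (c.reg x))
  | .store x s => some
      { c with
        pc := c.pc + 1
        mem := Function.update c.mem (c.reg x) (c.reg s)
        used := max c.used (c.reg x + 1) }
  | .jump l => some { c with pc := l }
  | .jumpLt x y l => some { c with pc := if c.reg x < c.reg y then l else c.pc + 1 }

/-- The space taken by a configuration, in bits: every register, and every memory cell up to the
last one accessed so far, takes the length of the binary notation of its contents (and `0` takes
one bit). In particular it is at least the number of registers and memory cells in use. -/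
def space (c : Config k) : ℕ :=
  ∑ i, max 1 (Nat.size (c.reg i)) + ∑ j ∈ Finset.range c.used, max 1 (Nat.size (c.mem j))

/-- The initial configuration on input `n`: register `0` holds `n`, everything else is `0`. -/
def init (k n : ℕ) : Config k where
  pc := 0
  reg i := if i.val = 0 then n else 0
  mem _ := 0
  used := 0

end Config

/-- The configuration reached by the program `P` from `c` in exactly `t` steps on a machine of
capacity `cap`, if there is one. -/
def Program.run {k : ℕ} (P : Program k) (cap : ℕ) : ℕ → Config k → Option (Config k)
  | 0, c => some c
  | t + 1, c => (P[c.pc]?).bind fun i => (c.exec cap i).bind fun c' => P.run cap t c'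

/-- On a machine of capacity `cap`, the program `P` started in `c` halts after exactly `t` steps
in the configuration `c'`; it halts by reaching an instruction number at which it has no
instruction. (A machine that is stuck has not halted.) -/
def Program.HaltsAfter {k : ℕ} (P : Program k) (cap : ℕ) (c : Config k) (t : ℕ)
    (c' : Config k) : Prop :=
  P.run cap t c = some c' ∧ P.length ≤ c'.pc

/-- The array `A 1, …, A n` is stored in the memory, beginning from the cell `base`, with `m`
elements packed in each cell, in consecutive fields of `w` bits, starting with the lowest bits. -/
def IsPackedArray (mem : ℕ → ℕ) (base m w n : ℕ) (A : ℕ → ℕ) : Prop :=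
  0 < m ∧ ∀ i < n, mem (base + i / m) / 2 ^ (w * (i % m)) % 2 ^ w = A (i + 1)

/-! The Zimin type is governed by short borders, those filling less than half of the word: a
nonempty word has type one more than the largest type of a short border
(`isZiminImage_succ_fibPrefix`). Borders of borders are borders, so the longest short border attains
this maximum (`zFib_eq_of_longest`).

If `2 * fib j ≤ n < 2 * fib (j + 1)`, say that `n` has level `j`. The longest short border of the
prefix of length `n` then has length `n - fib (j + 1)`. Indeed `fib (j + 1)` is a period of the
first `2 * fib (j + 1) - 1` letters. For `j ≥ 1`, a longer short border would give a period strictly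
between `fib j` and `fib (j + 1)`, and its difference from the period `fib j` would be too small a
period (`not_fibPeriod_of_lt`). Hence ZFib[n] = ZFib[n - fib (j + 1)] + 1
(`zFib_eq_zFib_sub_add_one`).

A single value is found by iterating this recursion while walking down the Fibonacci numbers. The
level never rises, and there are ZFib[n] ≤ log₂ (n + 1) subtractions, so logarithmic time and a
fixed number of registers suffice.

For the array, a digit takes about log log n bits and a cell has M digits, with M of order log n /
log log n, chosen so that a full cell is a number below C ≤ √n. Inside one level a cell is a window
of the earlier array, shifted by `fib (j + 1)`, with 1 added to each digit. The window straddles two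
adjacent earlier cells (`zFibCell_eq`). They are cut and joined in constant time by two tables of C
entries that depend only on `fib (j + 1)` modulo M. Cells that reach a new level are computed digit
by digit, and then the tables are rebuilt. There are O(log n) levels, so this costs O(√n log n) plus
a power of log n, against O(n / M) for the other cells.

Programs are written in a structured language with a weakest-precondition calculus that counts time,
and `Exec.run` transfers the results to the machine. Since no number may exceed n, conditions such
as `2 * x ≤ n` are tested through differences. -/

set_option linter.constructorNameAsVariable false

/-! ### A structured language for the machine -/

/-- Structured programs over a set `R` of register names. -/
inductive Stmt (R : Type)
  /-- `d := c` -/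
  | const (d : R) (c : ℕ)
  /-- `d := s` -/
  | copy (d s : R)
  /-- `d := x + y` -/
  | add (d x y : R)
  /-- `d := x - y` -/
  | sub (d x y : R)
  /-- `d := M[x]` -/
  | load (d x : R)
  /-- `M[x] := s` -/
  | store (x s : R)
  /-- first `s`, then `t` -/
  | seq (s t : Stmt R)
  /-- if `x < y` then `s` else `t` -/
  | ite (x y : R) (s t : Stmt R)
  /-- while `x < y` do `s` -/
  | loop (x y : R) (s : Stmt R)

infixr:60 " ;; " => Stmt.seq

/-- The state of a structured program: registers, memory, and the time spent so far. -/
@[ext]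
structure RamState (R : Type) where
  /-- the contents of the registers -/
  reg : R → ℕ
  /-- the contents of the memory -/
  mem : ℕ → ℕ
  /-- the time spent so far -/
  time : ℕ

namespace RamState

variable {R : Type}

/-- Spend one unit of time. -/
def tick (σ : RamState R) : RamState R := { σ with time := σ.time + 1 }

/-- Write `v` to the register `d`. -/
def set [DecidableEq R] (σ : RamState R) (d : R) (v : ℕ) : RamState R :=
  ⟨Function.update σ.reg d v, σ.mem, σ.time + 1⟩

/-- Write `v` to the memory cell `x`. -/
def setMem (σ : RamState R) (x v : ℕ) : RamState R :=
  ⟨σ.reg, Function.update σ.mem x v, σ.time + 1⟩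

@[simp] theorem tick_reg (σ : RamState R) : σ.tick.reg = σ.reg := rfl
@[simp] theorem tick_mem (σ : RamState R) : σ.tick.mem = σ.mem := rfl
@[simp] theorem tick_time (σ : RamState R) : σ.tick.time = σ.time + 1 := rfl
@[simp] theorem set_reg [DecidableEq R] (σ : RamState R) (d : R) (v : ℕ) (r : R) :
    (σ.set d v).reg r = if r = d then v else σ.reg r := by
  simp [set, Function.update_apply]
@[simp] theorem set_mem [DecidableEq R] (σ : RamState R) (d : R) (v : ℕ) : (σ.set d v).mem = σ.mem := rfl
@[simp] theorem set_time [DecidableEq R] (σ : RamState R) (d : R) (v : ℕ) :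
    (σ.set d v).time = σ.time + 1 := rfl
@[simp] theorem setMem_reg (σ : RamState R) (x v : ℕ) : (σ.setMem x v).reg = σ.reg := rfl
@[simp] theorem setMem_mem (σ : RamState R) (x v : ℕ) (j : ℕ) :
    (σ.setMem x v).mem j = if j = x then v else σ.mem j := by
  simp [setMem, Function.update_apply]
@[simp] theorem setMem_time (σ : RamState R) (x v : ℕ) :
    (σ.setMem x v).time = σ.time + 1 := rfl

end RamState

/-! ### Big-step semantics with time, and the weakest-precondition calculus. -/

namespace Stmt

variable {R : Type} [DecidableEq R]

/-- The big-step semantics on a machine of capacity `cap`. -/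
inductive Exec (cap : ℕ) : Stmt R → RamState R → RamState R → Prop
  | const {d c σ} : c ≤ cap → Exec cap (const d c) σ (σ.set d c)
  | copy {d s σ} : Exec cap (copy d s) σ (σ.set d (σ.reg s))
  | add {d x y σ} : σ.reg x + σ.reg y ≤ cap →
      Exec cap (add d x y) σ (σ.set d (σ.reg x + σ.reg y))
  | sub {d x y σ} : σ.reg y ≤ σ.reg x → Exec cap (sub d x y) σ (σ.set d (σ.reg x - σ.reg y))
  | load {d x σ} : Exec cap (load d x) σ (σ.set d (σ.mem (σ.reg x)))
  | store {x s σ} : Exec cap (store x s) σ (σ.setMem (σ.reg x) (σ.reg s))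
  | seq {s t σ σ₁ σ₂} : Exec cap s σ σ₁ → Exec cap t σ₁ σ₂ → Exec cap (seq s t) σ σ₂
  | iteTrue {x y s t σ σ'} : σ.reg x < σ.reg y → Exec cap s σ.tick σ' →
      Exec cap (ite x y s t) σ σ'
  | iteFalse {x y s t σ σ'} : ¬ σ.reg x < σ.reg y → Exec cap t σ.tick σ' →
      Exec cap (ite x y s t) σ σ'.tick
  | loopStep {x y s σ σ₁ σ₂} : σ.reg x < σ.reg y → Exec cap s σ.tick σ₁ →
      Exec cap (loop x y s) σ₁.tick σ₂ → Exec cap (loop x y s) σ σ₂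
  | loopEnd {x y s σ} : ¬ σ.reg x < σ.reg y → Exec cap (loop x y s) σ σ.tick.tick

/-- The registers that a structured program may change. -/
def writes : Stmt R → List R
  | const d _ => [d]
  | copy d _ => [d]
  | add d _ _ => [d]
  | sub d _ _ => [d]
  | load d _ => [d]
  | store _ _ => []
  | seq s t => s.writes ++ t.writes
  | ite _ _ s t => s.writes ++ t.writes
  | loop _ _ s => s.writes

/-- Does the structured program write to the memory? -/
def stores : Stmt R → Bool
  | store _ _ => true
  | seq s t => s.stores || t.stores
  | ite _ _ s t => s.stores || t.stores
  | loop _ _ s => s.stores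
  | _ => false

/-- The state `σ'` differs from `σ` only in what `s` may change. -/
structure Frame (s : Stmt R) (σ σ' : RamState R) : Prop where
  reg : ∀ r, r ∉ s.writes → σ'.reg r = σ.reg r
  mem : s.stores = false → σ'.mem = σ.mem

/-- Both conditions of a frame are syntactic, so for the concrete programs below `decide` settles
which registers and whether the memory survive. -/
theorem Exec.frame {cap : ℕ} {s : Stmt R} {σ σ' : RamState R} (h : Exec cap s σ σ') :
    s.Frame σ σ' := by
  induction h with
  | const | copy | add | sub | load =>
    exact ⟨fun r hr => by simp_all [writes], fun _ => rfl⟩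
  | store => exact ⟨fun r hr => rfl, fun h => by simp [stores] at h⟩
  | seq _ _ h1 h2 =>
    refine ⟨fun r hr => ?_, fun h => ?_⟩
    · simp only [writes, List.mem_append, not_or] at hr
      rw [h2.reg r hr.2, h1.reg r hr.1]
    · simp only [stores, Bool.or_eq_false_iff] at h
      rw [h2.mem h.2, h1.mem h.1]
  | iteTrue _ _ h1 =>
    refine ⟨fun r hr => ?_, fun h => ?_⟩
    · simp only [writes, List.mem_append, not_or] at hr
      exact h1.reg r hr.1
    · simp only [stores, Bool.or_eq_false_iff] at h
      exact h1.mem h.1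
  | iteFalse _ _ h1 =>
    refine ⟨fun r hr => ?_, fun h => ?_⟩
    · simp only [writes, List.mem_append, not_or] at hr
      exact h1.reg r hr.2
    · simp only [stores, Bool.or_eq_false_iff] at h
      exact h1.mem h.2
  | loopStep _ _ _ h1 h2 =>
    exact ⟨fun r hr => (h2.reg r hr).trans (h1.reg r hr), fun h => (h2.mem h).trans (h1.mem h)⟩
  | loopEnd => exact ⟨fun _ _ => rfl, fun _ => rfl⟩

/-- Started in `σ`, the program `s` ends in a state with the property `Q`. -/
def wp (cap : ℕ) (s : Stmt R) (σ : RamState R) (Q : RamState R → Prop) : Prop :=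
  ∃ σ', Exec cap s σ σ' ∧ Q σ'

variable {cap : ℕ} {σ : RamState R} {Q : RamState R → Prop}

@[simp] theorem wp_const {d : R} {c : ℕ} : wp cap (const d c) σ Q ↔ c ≤ cap ∧ Q (σ.set d c) :=
  ⟨fun ⟨_, h, hq⟩ => by cases h; exact ⟨by assumption, hq⟩, fun h => ⟨_, .const h.1, h.2⟩⟩

@[simp] theorem wp_copy {d s : R} : wp cap (copy d s) σ Q ↔ Q (σ.set d (σ.reg s)) :=
  ⟨fun ⟨_, h, hq⟩ => by cases h; exact hq, fun h => ⟨_, .copy, h⟩⟩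

@[simp] theorem wp_add {d x y : R} : wp cap (add d x y) σ Q ↔
    σ.reg x + σ.reg y ≤ cap ∧ Q (σ.set d (σ.reg x + σ.reg y)) :=
  ⟨fun ⟨_, h, hq⟩ => by cases h; exact ⟨by assumption, hq⟩, fun h => ⟨_, .add h.1, h.2⟩⟩

@[simp] theorem wp_sub {d x y : R} : wp cap (sub d x y) σ Q ↔
    σ.reg y ≤ σ.reg x ∧ Q (σ.set d (σ.reg x - σ.reg y)) :=
  ⟨fun ⟨_, h, hq⟩ => by cases h; exact ⟨by assumption, hq⟩, fun h => ⟨_, .sub h.1, h.2⟩⟩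

@[simp] theorem wp_load {d x : R} : wp cap (load d x) σ Q ↔ Q (σ.set d (σ.mem (σ.reg x))) :=
  ⟨fun ⟨_, h, hq⟩ => by cases h; exact hq, fun h => ⟨_, .load, h⟩⟩

@[simp] theorem wp_store {x s : R} : wp cap (store x s) σ Q ↔ Q (σ.setMem (σ.reg x) (σ.reg s)) :=
  ⟨fun ⟨_, h, hq⟩ => by cases h; exact hq, fun h => ⟨_, .store, h⟩⟩

@[simp] theorem wp_seq {s t : Stmt R} :
    wp cap (s ;; t) σ Q ↔ wp cap s σ fun σ₁ => wp cap t σ₁ Q := by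
  constructor
  · rintro ⟨_, h, hq⟩
    cases h with | seq h1 h2 => exact ⟨_, h1, _, h2, hq⟩
  · rintro ⟨_, h1, _, h2, hq⟩
    exact ⟨_, .seq h1 h2, hq⟩

@[simp] theorem wp_ite {x y : R} {s t : Stmt R} : wp cap (ite x y s t) σ Q ↔
    (σ.reg x < σ.reg y → wp cap s σ.tick Q) ∧
    (¬ σ.reg x < σ.reg y → wp cap t σ.tick fun σ' => Q σ'.tick) := by
  constructor
  · rintro ⟨_, h, hq⟩
    cases h with
    | iteTrue h h1 => exact ⟨fun _ => ⟨_, h1, hq⟩, fun h' => absurd h h'⟩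
    | iteFalse h h1 => exact ⟨fun h' => absurd h' h, fun _ => ⟨_, h1, hq⟩⟩
  · rintro ⟨h1, h2⟩
    by_cases h : σ.reg x < σ.reg y
    · obtain ⟨_, h3, hq⟩ := h1 h
      exact ⟨_, .iteTrue h h3, hq⟩
    · obtain ⟨_, h3, hq⟩ := h2 h
      exact ⟨_, .iteFalse h h3, hq⟩

/-- The rule of consequence, with what the program leaves unchanged. -/
theorem wp.mono {s : Stmt R} {Q' : RamState R → Prop} (h : wp cap s σ Q)
    (hQ : ∀ σ', s.Frame σ σ' → Q σ' → Q' σ') : wp cap s σ Q' := by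
  obtain ⟨σ', h1, h2⟩ := h
  exact ⟨σ', h1, hQ σ' h1.frame h2⟩

/-- The rule for loops, with an invariant `I` and a decreasing measure `μ`. -/
theorem wp_loop {x y : R} {s : Stmt R} (I : RamState R → Prop) (μ : RamState R → ℕ)
    (h0 : I σ)
    (hs : ∀ σ₁, s.Frame σ σ₁ → I σ₁ → σ₁.reg x < σ₁.reg y →
      wp cap s σ₁.tick fun σ₂ => I σ₂.tick ∧ μ σ₂.tick < μ σ₁)
    (he : ∀ σ₁, s.Frame σ σ₁ → I σ₁ → ¬ σ₁.reg x < σ₁.reg y → Q σ₁.tick.tick) :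
    wp cap (loop x y s) σ Q := by
  have key : ∀ k σ₁, μ σ₁ = k → s.Frame σ σ₁ → I σ₁ → wp cap (loop x y s) σ₁ Q := by
    intro k
    induction k using Nat.strong_induction_on with
    | _ k ih =>
      intro σ₁ hk hf hI
      by_cases h : σ₁.reg x < σ₁.reg y
      · obtain ⟨σ₂, h1, hI2, hμ⟩ := hs σ₁ hf hI h
        have hf2 := h1.frame
        obtain ⟨σ₃, h3, hQ⟩ := ih _ (hk ▸ hμ) σ₂.tick rfl
          ⟨fun r hr => (hf2.reg r hr).trans (hf.reg r hr),
            fun h => (hf2.mem h).trans (hf.mem h)⟩ hI2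
        exact ⟨σ₃, .loopStep h h1 h3, hQ⟩
      · exact ⟨_, .loopEnd h, he σ₁ hf hI h⟩
  exact key _ σ rfl ⟨fun _ _ => rfl, fun _ => rfl⟩ h0

end Stmt

namespace Stmt

variable {R : Type}

/-! #### Compilation -/

/-- The number of instructions of the compiled program. -/
def size : Stmt R → ℕ
  | seq s t => s.size + t.size
  | ite _ _ s t => s.size + t.size + 2
  | loop _ _ s => s.size + 3
  | _ => 1

/-- The code of a structured program that is to be placed at the address `base`. -/
def compile {K : ℕ} (ι : R → Fin K) : ℕ → Stmt R → Program K
  | _, const d c => [.const (ι d) c]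
  | _, copy d s => [.copy (ι d) (ι s)]
  | _, add d x y => [.add (ι d) (ι x) (ι y)]
  | _, sub d x y => [.sub (ι d) (ι x) (ι y)]
  | _, load d x => [.load (ι d) (ι x)]
  | _, store x s => [.store (ι x) (ι s)]
  | base, seq s t => compile ι base s ++ compile ι (base + s.size) t
  | base, ite x y s t =>
    [.jumpLt (ι x) (ι y) (base + t.size + 2)] ++ compile ι (base + 1) t ++
      [.jump (base + t.size + 2 + s.size)] ++ compile ι (base + t.size + 2) s
  | base, loop x y s =>
    [.jumpLt (ι x) (ι y) (base + 2), .jump (base + 2 + s.size + 1)] ++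
      compile ι (base + 2) s ++ [.jump base]

theorem length_compile {K : ℕ} (ι : R → Fin K) (s : Stmt R) (base : ℕ) :
    (s.compile ι base).length = s.size := by
  induction s generalizing base with
  | seq s t h1 h2 => simp [compile, size, h1, h2]
  | ite x y s t h1 h2 => simp [compile, size, h1, h2]; omega
  | loop x y s h1 => simp [compile, size, h1]
  | _ => rfl

end Stmt

theorem Program.run_add {K : ℕ} (P : Program K) (cap s t : ℕ) (c : Config K) :
    P.run cap (s + t) c = (P.run cap s c).bind (P.run cap t) := by
  induction s generalizing c with
  | zero => simp [Program.run]
  | succ s ih =>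
    rw [Nat.succ_add, Program.run, Program.run, Option.bind_assoc]
    congr 1; funext i
    rw [Option.bind_assoc]
    congr 1; funext c'
    exact ih c'

theorem Program.run_trans {K : ℕ} {P : Program K} {cap s t : ℕ} {c c₁ c₂ : Config K}
    (h1 : P.run cap s c = some c₁) (h2 : P.run cap t c₁ = some c₂) :
    P.run cap (s + t) c = some c₂ := by
  rw [Program.run_add, h1, Option.bind_some, h2]

theorem Program.run_one {K : ℕ} {pre post : Program K} {i : Instr K} {cap : ℕ}
    {c : Config K} (hc : c.pc = pre.length) :
    Program.run (pre ++ i :: post) cap 1 c = c.exec cap i := by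
  simp [Program.run, hc]

namespace Stmt

variable {R : Type} [DecidableEq R]

/-- No register or memory cell exceeds the capacity. -/
def Bounded (cap : ℕ) (σ : RamState R) : Prop :=
  (∀ r, σ.reg r ≤ cap) ∧ ∀ j, σ.mem j ≤ cap

/-- The configuration `c` represents the state `σ`. -/
def Repr {K : ℕ} (ι : R → Fin K) (σ : RamState R) (c : Config K) : Prop :=
  (∀ r, c.reg (ι r) = σ.reg r) ∧ c.mem = σ.mem

theorem Bounded.set {cap : ℕ} {σ : RamState R} (h : Bounded cap σ) {d : R} {v : ℕ}
    (hv : v ≤ cap) : Bounded cap (σ.set d v) :=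
  ⟨fun r => by rw [RamState.set_reg]; split_ifs; exacts [hv, h.1 r], h.2⟩

theorem write_repr {K : ℕ} {ι : R → Fin K} (hι : Function.Injective ι) {cap : ℕ}
    {σ : RamState R} {c : Config K} (hr : Repr ι σ c) {d : R} {v : ℕ} (hv : v ≤ cap) :
    ∃ c', c.write cap (ι d) v = some c' ∧ c'.pc = c.pc + 1 ∧ Repr ι (σ.set d v) c' := by
  refine ⟨⟨c.pc + 1, Function.update c.reg (ι d) v, c.mem, c.used⟩,
    by rw [Config.write, if_pos hv], rfl, fun r => ?_, hr.2⟩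
  simp only [Function.update_apply, hι.eq_iff, RamState.set_reg, hr.1 r]

/-- Induction on the execution, for code embedded at its absolute address `pre.length` because jump
targets are absolute. `Bounded` is carried along since the machine also checks the capacity for
copies, differences and loads, where the structured semantics does not. -/
theorem Exec.run {K : ℕ} {ι : R → Fin K} (hι : Function.Injective ι) {cap : ℕ}
    {s : Stmt R} {σ σ' : RamState R} (h : Exec cap s σ σ') (hb : Bounded cap σ)
    {P pre post : Program K} (hP : P = pre ++ s.compile ι pre.length ++ post)
    {c : Config K} (hc : c.pc = pre.length) (hr : Repr ι σ c) :
    Bounded cap σ' ∧ ∃ t c', σ'.time = σ.time + t ∧ P.run cap t c = some c' ∧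
      c'.pc = pre.length + s.size ∧ Repr ι σ' c' := by
  induction h generalizing pre post c with
  | const hv =>
    refine ⟨hb.set hv, 1, ?_⟩
    obtain ⟨c', h1, h2, h3⟩ := write_repr hι hr hv
    refine ⟨c', rfl, ?_, by rw [h2, hc]; rfl, h3⟩
    rw [hP, compile, List.append_assoc, List.singleton_append, Program.run_one hc]; exact h1
  | @copy d s σ =>
    have hv : σ.reg s ≤ cap := hb.1 _
    refine ⟨hb.set hv, 1, ?_⟩
    obtain ⟨c', h1, h2, h3⟩ := write_repr hι hr hv
    refine ⟨c', rfl, ?_, by rw [h2, hc]; rfl, h3⟩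
    rw [hP, compile, List.append_assoc, List.singleton_append, Program.run_one hc, Config.exec,
      hr.1]
    exact h1
  | add hv =>
    refine ⟨hb.set hv, 1, ?_⟩
    obtain ⟨c', h1, h2, h3⟩ := write_repr hι hr hv
    refine ⟨c', rfl, ?_, by rw [h2, hc]; rfl, h3⟩
    rw [hP, compile, List.append_assoc, List.singleton_append, Program.run_one hc, Config.exec,
      hr.1, hr.1]
    exact h1
  | @sub d x y σ hxy =>
    have hv : σ.reg x - σ.reg y ≤ cap := (Nat.sub_le _ _).trans (hb.1 _)
    refine ⟨hb.set hv, 1, ?_⟩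
    obtain ⟨c', h1, h2, h3⟩ := write_repr hι hr hv
    refine ⟨c', rfl, ?_, by rw [h2, hc]; rfl, h3⟩
    rw [hP, compile, List.append_assoc, List.singleton_append, Program.run_one hc, Config.exec,
      hr.1, hr.1, if_pos hxy]
    exact h1
  | @load d x σ =>
    have hv : σ.mem (σ.reg x) ≤ cap := hb.2 _
    refine ⟨hb.set hv, 1, ?_⟩
    obtain ⟨c', h1, h2, h3⟩ := write_repr hι
      (c := { c with used := max c.used (c.reg (ι x) + 1) }) hr hv
    refine ⟨c', rfl, ?_, by rw [h2]; simp [hc, size], h3⟩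
    rw [hP, compile, List.append_assoc, List.singleton_append, Program.run_one hc, Config.exec,
      hr.2, hr.1, ← h1, hr.1, hr.2]
  | @store x s σ =>
    refine ⟨⟨hb.1, fun j => ?_⟩, 1, ?_⟩
    · rw [RamState.setMem_mem]; split_ifs; exacts [hb.1 _, hb.2 _]
    refine ⟨⟨c.pc + 1, c.reg, Function.update c.mem (c.reg (ι x)) (c.reg (ι s)),
      max c.used (c.reg (ι x) + 1)⟩, rfl, ?_, ?_, hr.1, ?_⟩
    · rw [hP, compile, List.append_assoc, List.singleton_append, Program.run_one hc, Config.exec]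
    · simp [hc, size]
    · simp [hr.1, hr.2, RamState.setMem]
  | @seq s t σ σ₁ σ₂ _ _ ih1 ih2 =>
    obtain ⟨hb1, t1, c1, ht1, hr1, hp1, hs1⟩ := ih1 hb (pre := pre)
      (post := t.compile ι (pre.length + s.size) ++ post)
      (by simp [hP, compile]) hc hr
    obtain ⟨hb2, t2, c2, ht2, hr2, hp2, hs2⟩ := ih2 hb1 (pre := pre ++ s.compile ι pre.length)
      (post := post) (by simp [hP, compile, length_compile])
      (by simp [hp1, length_compile]) hs1
    refine ⟨hb2, t1 + t2, c2, by omega, Program.run_trans hr1 hr2, ?_, hs2⟩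
    rw [hp2, List.length_append, length_compile, size]; omega
  | @iteTrue x y s t σ σ' hlt _ ih =>
    have h0 : P.run cap 1 c = some { c with pc := pre.length + t.size + 2 } := by
      rw [hP, compile]
      simp only [List.append_assoc, List.cons_append, List.nil_append]
      rw [Program.run_one hc, Config.exec, hr.1, hr.1, if_pos hlt]
    obtain ⟨hb1, t1, c1, ht1, hr1, hp1, hs1⟩ := ih (c := { c with pc := pre.length + t.size + 2 })
      hb (pre := pre ++ ([.jumpLt (ι x) (ι y) (pre.length + t.size + 2)] ++
        t.compile ι (pre.length + 1) ++ [.jump (pre.length + t.size + 2 + s.size)]))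
      (post := post)
      (by
        rw [hP, compile]
        have : (pre ++ ([Instr.jumpLt (ι x) (ι y) (pre.length + t.size + 2)] ++
            t.compile ι (pre.length + 1) ++
              [Instr.jump (pre.length + t.size + 2 + s.size)])).length =
            pre.length + t.size + 2 := by
          simp [length_compile]; omega
        rw [this]; simp)
      (by simp [length_compile]; omega) hr
    refine ⟨hb1, 1 + t1, c1, by simp [ht1]; omega, Program.run_trans h0 hr1, ?_, hs1⟩
    rw [hp1]; simp [length_compile, size]; omega
  | @iteFalse x y s t σ σ' hlt _ ih =>
    have h0 : P.run cap 1 c = some { c with pc := pre.length + 1 } := by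
      rw [hP, compile]
      simp only [List.append_assoc, List.cons_append, List.nil_append]
      rw [Program.run_one hc, Config.exec, hr.1, hr.1, if_neg hlt, hc]
    obtain ⟨hb1, t1, c1, ht1, hr1, hp1, hs1⟩ := ih (c := { c with pc := pre.length + 1 })
      hb (pre := pre ++ [.jumpLt (ι x) (ι y) (pre.length + t.size + 2)])
      (post := .jump (pre.length + t.size + 2 + s.size) ::
        s.compile ι (pre.length + t.size + 2) ++ post)
      (by rw [hP, compile]; simp)
      (by simp) hr
    have h2 : P.run cap 1 c1 = some { c1 with pc := pre.length + t.size + 2 + s.size } := by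
      have : P = (pre ++ [.jumpLt (ι x) (ι y) (pre.length + t.size + 2)] ++
          t.compile ι (pre.length + 1)) ++ .jump (pre.length + t.size + 2 + s.size) ::
          (s.compile ι (pre.length + t.size + 2) ++ post) := by
        rw [hP, compile]; simp
      rw [this, Program.run_one (by rw [hp1]; simp [length_compile]; omega), Config.exec]
    refine ⟨hb1, 1 + t1 + 1, _, by simp [ht1]; omega,
      Program.run_trans (Program.run_trans h0 hr1) h2, ?_, hs1⟩
    simp [size]; omega
  | @loopStep x y s σ σ₁ σ₂ hlt _ _ ih1 ih2 =>
    have h0 : P.run cap 1 c = some { c with pc := pre.length + 2 } := by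
      rw [hP, compile]
      simp only [List.append_assoc, List.cons_append]
      rw [Program.run_one hc, Config.exec, hr.1, hr.1, if_pos hlt]
    obtain ⟨hb1, t1, c1, ht1, hr1, hp1, hs1⟩ := ih1 (c := { c with pc := pre.length + 2 })
      hb (pre := pre ++ [.jumpLt (ι x) (ι y) (pre.length + 2),
        .jump (pre.length + 2 + s.size + 1)])
      (post := .jump pre.length :: post)
      (by rw [hP, compile]; simp)
      (by simp) hr
    have h2 : P.run cap 1 c1 = some { c1 with pc := pre.length } := by
      have : P = (pre ++ [.jumpLt (ι x) (ι y) (pre.length + 2),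
          .jump (pre.length + 2 + s.size + 1)] ++ s.compile ι (pre.length + 2)) ++
          .jump pre.length :: post := by
        rw [hP, compile]; simp
      rw [this, Program.run_one (by rw [hp1]; simp [length_compile]; omega), Config.exec]
    obtain ⟨hb2, t2, c2, ht2, hr2, hp2, hs2⟩ := ih2 (c := { c1 with pc := pre.length })
      hb1 hP rfl hs1
    refine ⟨hb2, 1 + t1 + 1 + t2, c2, by simp at ht1 ht2; omega,
      Program.run_trans (Program.run_trans (Program.run_trans h0 hr1) h2) hr2, hp2, hs2⟩
  | @loopEnd x y s σ hlt =>
    have h0 : P.run cap 1 c = some { c with pc := pre.length + 1 } := by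
      rw [hP, compile]
      simp only [List.append_assoc, List.cons_append]
      rw [Program.run_one hc, Config.exec, hr.1, hr.1, if_neg hlt, hc]
    have h1 : P.run cap 1 { c with pc := pre.length + 1 } =
        some { c with pc := pre.length + 2 + s.size + 1 } := by
      have : P = (pre ++ [.jumpLt (ι x) (ι y) (pre.length + 2)]) ++
          .jump (pre.length + 2 + s.size + 1) ::
          (s.compile ι (pre.length + 2) ++ .jump pre.length :: post) := by
        rw [hP, compile]; simp
      rw [this, Program.run_one (by simp), Config.exec]
    exact ⟨hb, 2, _, rfl, Program.run_trans h0 h1, by simp [size]; omega, hr⟩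

/-- From the wp calculus to the machine: a program that is started with the input in the
register `r₀` and everything else `0`. -/
theorem wp.haltsAfter {K : ℕ} {ι : R → Fin K} (hι : Function.Injective ι) {r₀ : R}
    (h₀ : (ι r₀).val = 0) {n : ℕ} {s : Stmt R} {Q : RamState R → Prop}
    (h : wp n s ⟨fun r => if r = r₀ then n else 0, fun _ => 0, 0⟩ Q) :
    ∃ (t : ℕ) (c : Config K) (σ : RamState R),
      Program.HaltsAfter (s.compile ι 0) n (Config.init K n) t c ∧ Q σ ∧ t = σ.time ∧
      (∀ r, c.reg (ι r) = σ.reg r) ∧ c.mem = σ.mem := by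
  obtain ⟨σ, hs, hQ⟩ := h
  obtain ⟨-, t, c, ht, hrun, hpc, hr⟩ := hs.run hι (P := s.compile ι 0) (pre := []) (post := [])
    (c := Config.init K n)
    ⟨fun r => by dsimp only; split_ifs; exacts [le_rfl, Nat.zero_le _], fun _ => Nat.zero_le _⟩
    (by simp) rfl
    ⟨fun r => by
      have : (ι r).val = 0 ↔ r = r₀ := by
        rw [← h₀, ← Fin.ext_iff, hι.eq_iff]
      simp [Config.init, this], rfl⟩
  refine ⟨t, c, σ, ⟨hrun, ?_⟩, hQ, by simp at ht; omega, hr.1, hr.2⟩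
  rw [hpc, length_compile]; simp

end Stmt

/-! ### Zimin types of the prefixes of an infinite word -/

theorem le_of_mem_ziminWord {k x : ℕ} (hx : x ∈ ziminWord k) : x ≤ k := by
  induction k with
  | zero => simp [ziminWord] at hx
  | succ k ih =>
    simp only [ziminWord, List.mem_append, List.mem_singleton] at hx
    rcases hx with (hx | hx) | hx
    · exact (ih hx).trans k.le_succ
    · omega
    · exact (ih hx).trans k.le_succ

/-- The variable `k + 1` occurs once in the Zimin word of rank `k + 1` and not in that of rank `k`,
so its image can be chosen freely. -/
theorem isZiminImage_succ {α : Type*} {k : ℕ} {w : List α} :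
    IsZiminImage (k + 1) w ↔ ∃ u v, IsZiminImage k u ∧ v ≠ [] ∧ w = u ++ v ++ u := by
  constructor
  · rintro ⟨h, hne, rfl⟩
    refine ⟨(ziminWord k).flatMap h, h (k + 1), ⟨h, fun x hx => hne x ?_, rfl⟩, hne _ ?_, ?_⟩
    · simp [ziminWord, hx]
    · simp [ziminWord]
    · simp [ziminWord]
  · rintro ⟨_, v, ⟨h, hne, rfl⟩, hv, rfl⟩
    have hflat : (ziminWord k).flatMap (Function.update h (k + 1) v) = (ziminWord k).flatMap h := by
      rw [List.flatMap_def, List.flatMap_def]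
      congr 1
      refine List.map_congr_left fun x hx => Function.update_of_ne ?_ _ _
      have := le_of_mem_ziminWord hx
      omega
    refine ⟨Function.update h (k + 1) v, fun x hx => ?_, ?_⟩
    · by_cases hx' : x = k + 1
      · simpa [hx'] using hv
      · rw [Function.update_of_ne hx']
        refine hne x ?_
        simpa [ziminWord, hx'] using hx
    · simp only [ziminWord, List.flatMap_append, hflat]
      simp

/-- The prefix of length `n` of the infinite Fibonacci word has the period `p`. -/
def FibPeriod (p n : ℕ) : Prop :=
  ∀ i, i + p < n → fibInfinite (i + p) = fibInfinite i

theorem FibPeriod.mono {p n m : ℕ} (h : FibPeriod p n) (hm : m ≤ n) : FibPeriod p m :=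
  fun i hi => h i (hi.trans_le hm)

/-- A border of length `m` is the same as a period `n - m`; from here on words are replaced by
periods and lengths. -/
theorem fibPrefix_eq_append {n m : ℕ} {u v : List FibLetter} (hm : u.length = m) :
    fibPrefix n = u ++ v ++ u ↔
      u = fibPrefix m ∧ n = 2 * m + v.length ∧ v = ((fibPrefix n).drop m).take v.length ∧
        FibPeriod (n - m) n := by
  subst hm
  have hlen : ∀ n, (fibPrefix n).length = n := fun n => by simp [fibPrefix]
  have hget : ∀ n i (hi : i < (fibPrefix n).length), (fibPrefix n)[i] = fibInfinite i := by
    intro n i hi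
    simp [fibPrefix]
  constructor
  · intro h
    have hn : n = 2 * u.length + v.length := by
      have := congrArg List.length h
      simp only [hlen, List.length_append] at this
      omega
    have hu : u = fibPrefix u.length := by
      refine List.ext_getElem (by rw [hlen]) fun i h1 h2 => ?_
      rw [hget, ← hget n i (by rw [hlen]; omega)]
      simp only [h]
      rw [List.getElem_append_left (by simp; omega), List.getElem_append_left h1]
    refine ⟨hu, hn, ?_, fun i hi => ?_⟩
    · rw [h]; simp
    · rw [← hget n (i + (n - u.length)) (by rw [hlen]; omega)]
      have h1 : i < u.length := by omega
      have h2 : fibInfinite i = u[i] := by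
        rw [← hget u.length i (by rw [hlen]; omega)]
        exact List.getElem_of_eq hu.symm _
      rw [h2]
      simp only [h]
      rw [List.getElem_append_right (by simp; omega)]
      congr 1
      simp; omega
  · rintro ⟨hu, hn, hv, hp⟩
    refine List.ext_getElem (by rw [hlen]; simp; omega) fun i h1 h2 => ?_
    rw [hlen] at h1
    rw [hget]
    by_cases hi : i < u.length
    · rw [List.getElem_append_left (by simp; omega), List.getElem_append_left hi,
        List.getElem_of_eq hu, hget]
    · by_cases hi' : i < u.length + v.length
      · rw [List.getElem_append_left (by simp; omega), List.getElem_append_right (by omega),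
          List.getElem_of_eq hv, List.getElem_take, List.getElem_drop, hget]
        congr 1; omega
      · rw [List.getElem_append_right (by simp; omega), List.getElem_of_eq hu, hget,
          ← hp (i - (u ++ v).length) (by rw [List.length_append]; omega)]
        congr 1; rw [List.length_append]; omega

/-- The recursive characterization of the Zimin types by short borders. -/
theorem isZiminImage_succ_fibPrefix {k n : ℕ} :
    IsZiminImage (k + 1) (fibPrefix n) ↔
      ∃ m, 2 * m < n ∧ FibPeriod (n - m) n ∧ IsZiminImage k (fibPrefix m) := by
  rw [isZiminImage_succ]
  constructor
  · rintro ⟨u, v, hu, hv, h⟩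
    obtain ⟨h1, h2, -, h4⟩ := (fibPrefix_eq_append rfl).1 h
    have := List.length_pos_of_ne_nil hv
    exact ⟨u.length, by omega, h4, h1 ▸ hu⟩
  · rintro ⟨m, hm, hp, hk⟩
    have hlen : ∀ n, (fibPrefix n).length = n := fun n => by simp [fibPrefix]
    have hl : (((fibPrefix n).drop m).take (n - 2 * m)).length = n - 2 * m := by
      simp [hlen]; omega
    refine ⟨fibPrefix m, ((fibPrefix n).drop m).take (n - 2 * m), hk, ?_, ?_⟩
    · rw [← List.length_pos_iff, hl]; omega
    · rw [fibPrefix_eq_append (hlen m)]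
      exact ⟨rfl, by omega, by rw [hl], hp⟩

theorem zFib_isZiminImage (n : ℕ) : IsZiminImage (zFib n) (fibPrefix n) :=
  (ziminType_isGreatest _).1

theorem le_zFib {k n : ℕ} (h : IsZiminImage k (fibPrefix n)) : k ≤ zFib n :=
  (ziminType_isGreatest _).2 h

theorem zFib_lt_of_fibPeriod {n m : ℕ} (hm : 2 * m < n) (hp : FibPeriod (n - m) n) :
    zFib m < zFib n :=
  le_zFib (isZiminImage_succ_fibPrefix.2 ⟨m, hm, hp, zFib_isZiminImage m⟩)

theorem zFib_zero : zFib 0 = 0 :=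
  Nat.le_zero.1 (by simpa [fibPrefix, zFib] using (zFib_isZiminImage 0).le_length)

theorem exists_zFib_eq_succ {n : ℕ} (hn : 1 ≤ n) :
    ∃ m, 2 * m < n ∧ FibPeriod (n - m) n ∧ zFib n = zFib m + 1 := by
  have hpos : 0 < zFib n := by
    -- The empty border: its period `n` holds vacuously.
    have := zFib_lt_of_fibPeriod (n := n) (m := 0) (by omega) fun i hi => by omega
    omega
  obtain ⟨k, hk⟩ := Nat.exists_eq_succ_of_ne_zero hpos.ne'
  have := zFib_isZiminImage n
  rw [hk] at this
  obtain ⟨m, hm, hp, hkm⟩ := isZiminImage_succ_fibPrefix.1 this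
  have h1 := le_zFib hkm
  have h2 := zFib_lt_of_fibPeriod hm hp
  exact ⟨m, hm, hp, by omega⟩

/-- Each passage to a short border more than halves the length. -/
theorem two_pow_zFib_le (n : ℕ) : 2 ^ zFib n ≤ n + 1 := by
  induction n using Nat.strong_induction_on with
  | _ n ih =>
    rcases Nat.eq_zero_or_pos n with rfl | hn
    · simp [zFib_zero]
    · obtain ⟨m, hm, -, h⟩ := exists_zFib_eq_succ hn
      have := ih m (by omega)
      rw [h, pow_succ]; omega

/-! ### Nested borders. -/

/-- A border of a border is a border. -/
theorem fibPeriod_border {n m l : ℕ} (hmn : m ≤ n) (hlm : l ≤ m) (hm : FibPeriod (n - m) n)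
    (hl : FibPeriod (m - l) m) : FibPeriod (n - l) n := by
  intro i hi
  have h1 := hm (i + (m - l)) (by omega)
  rw [hl i (by omega)] at h1
  rw [← h1]; congr 1; omega

theorem fibPeriod_of_borders {n m l : ℕ} (hmn : m ≤ n) (hlm : l ≤ m) (hm : FibPeriod (n - m) n)
    (hl : FibPeriod (n - l) n) : FibPeriod (m - l) m := by
  intro i hi
  have h1 := hm (i + (m - l)) (by omega)
  have h2 := hl i (by omega)
  rw [← h1, ← h2]; congr 1; omega

/-- The longest short border decides. -/
theorem zFib_eq_of_longest {n m : ℕ} (hm : 2 * m < n) (hp : FibPeriod (n - m) n)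
    (hmax : ∀ l, 2 * l < n → FibPeriod (n - l) n → l ≤ m) : zFib n = zFib m + 1 := by
  refine le_antisymm ?_ (zFib_lt_of_fibPeriod hm hp)
  obtain ⟨l, hl, hpl, h⟩ := exists_zFib_eq_succ (n := n) (by omega)
  have hlm := hmax l hl hpl
  rw [h, Nat.add_le_add_iff_right]
  -- A short border `k` of the prefix `l` is also a border of the prefix `m`, and short there
  -- because `2 * k < l ≤ m`; hence `zFib l = zFib k + 1 ≤ zFib m`.
  rcases Nat.eq_zero_or_pos l with rfl | hl0
  · simp [zFib_zero]
  · obtain ⟨k, hk, hpk, h'⟩ := exists_zFib_eq_succ hl0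
    rw [h']
    refine zFib_lt_of_fibPeriod (by omega) ?_
    exact fibPeriod_border hlm (by omega) (fibPeriod_of_borders (by omega) hlm hp hpl) hpk

/-! ### Periods of the prefixes of the infinite Fibonacci word -/

theorem length_fibWord (n : ℕ) : (fibWord n).length = Nat.fib (n + 1) := by
  induction n using Nat.twoStepInduction with
  | zero => rfl
  | one => rfl
  | more n h1 h2 =>
    rw [fibWord, List.length_append, h1, h2, Nat.fib_add_two (n := n + 1)]; omega

/-- `F_{j+1} = F_j F_{j-1}`. -/
theorem fibInfinite_fib_add {j x : ℕ} (hj : 2 ≤ j) (hx : x < Nat.fib j) :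
    fibInfinite (x + Nat.fib (j + 1)) = fibInfinite x := by
  obtain ⟨j, rfl⟩ := Nat.exists_eq_add_of_le' hj
  have e1 := length_fibWord (j + 2)
  have e2 := length_fibWord (j + 1)
  rw [fibInfinite_eq_getElem (j + 2) _ (by
      rw [length_fibWord, Nat.fib_add_two (n := j + 2)]; omega),
    fibInfinite_eq_getElem j x (by rw [e2]; exact hx)]
  simp only [show fibWord (j + 2 + 1) = fibWord (j + 2) ++ fibWord (j + 1) from rfl]
  rw [List.getElem_append_right (by omega)]
  congr 1
  omega

/-- The words F_j F_{j-1} and F_{j-1} F_j agree except in their last two letters. In the induction,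
positions beyond `fib j` are reduced to the previous period. -/
theorem fibPeriod_fib {j : ℕ} (hj : 2 ≤ j) : FibPeriod (Nat.fib j) (Nat.fib (j + 2) - 2) := by
  induction j, hj using Nat.le_induction with
  | base => intro i hi; simp [Nat.fib_add_two] at hi
  | succ j hj ih =>
    intro i hi
    have e1 := Nat.fib_add_two (n := j)
    have e2 := Nat.fib_add_two (n := j + 1)
    simp only [add_assoc, Nat.reduceAdd] at e2 hi ih ⊢
    by_cases hij : i < Nat.fib j
    · exact fibInfinite_fib_add hj hij
    · obtain ⟨y, rfl⟩ := Nat.exists_eq_add_of_le' (not_lt.1 hij)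
      rw [ih y (by omega), ← fibInfinite_fib_add (j := j + 1) (x := y) (by omega) (by omega)]
      congr 1
      simp only [add_assoc, Nat.reduceAdd]; omega

/-- The Fibonacci words end alternately in ab and ba; these are their last letters but one. It is
the place where the period of `fibPeriod_fib` breaks. -/
theorem fibInfinite_fib_sub_two_ne {j : ℕ} (hj : 3 ≤ j) :
    fibInfinite (Nat.fib (j + 1) - 2) ≠ fibInfinite (Nat.fib j - 2) := by
  induction j, hj using Nat.le_induction with
  | base => decide
  | succ j hj ih =>
    have e1 : Nat.fib (j + 1 + 1) = Nat.fib j + Nat.fib (j + 1) := Nat.fib_add_two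
    have : 2 ≤ Nat.fib j := Nat.fib_mono hj
    have h := fibInfinite_fib_add (j := j) (x := Nat.fib j - 2) (by omega) (by omega)
    have h' : Nat.fib (j + 1 + 1) - 2 = Nat.fib j - 2 + Nat.fib (j + 1) := by omega
    rw [h', h]
    exact ih.symm

/-- Strong induction, after replacing `j` by `j + 3`, comparing `r` with the known period `fib (j +
2)`. A smaller `r` already fails on a shorter prefix. -/
theorem not_fibPeriod_of_lt {j r : ℕ} (hr : 0 < r) (hrj : r < Nat.fib j) :
    ¬ FibPeriod r (Nat.fib (j + 1) - 1) := by
  induction j using Nat.strong_induction_on generalizing r with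
  | _ j ih =>
    intro h
    have hj : 3 ≤ j := by
      by_contra hj
      have : Nat.fib j ≤ Nat.fib 2 := Nat.fib_mono (by omega)
      simp at this; omega
    obtain ⟨j, rfl⟩ := Nat.exists_eq_add_of_le' hj
    have e1 := Nat.fib_add_two (n := j)
    have e2 := Nat.fib_add_two (n := j + 1)
    have e3 := Nat.fib_add_two (n := j + 2)
    have p1 : 0 < Nat.fib (j + 1) := Nat.fib_pos.2 (by omega)
    simp only [add_assoc, Nat.reduceAdd] at e2 e3 h
    have hge : Nat.fib (j + 2) ≤ r := by
      by_contra hlt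
      exact ih (j + 2) (by omega) hr (by omega) (h.mono (by simp only [add_assoc, Nat.reduceAdd]; omega))
    rcases hge.eq_or_lt with rfl | hgt
    -- The period `fib (j + 2)` is violated by the last letter of this prefix.
    · have : 2 ≤ Nat.fib (j + 3) := Nat.fib_mono (show 3 ≤ j + 3 by omega)
      have h1 := h (Nat.fib (j + 3) - 2) (by omega)
      apply fibInfinite_fib_sub_two_ne (j := j + 3) (by omega)
      rw [← h1]; congr 1
      simp only [add_assoc, Nat.reduceAdd]; omega
    -- The difference `s + 1` of the two periods would be a period of the first `fib (j + 2) - 1`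
    -- letters, although it is less than `fib (j + 1)`.
    · obtain ⟨s, rfl⟩ := Nat.exists_eq_add_of_lt hgt
      refine ih (j + 1) (by omega) (r := s + 1) (by omega) (by omega) fun i hi => ?_
      have h1 := h i (by simp only [add_assoc, Nat.reduceAdd] at *; omega)
      have h2 := fibPeriod_fib (j := j + 2) (by omega) (i + (s + 1))
        (by simp only [add_assoc, Nat.reduceAdd] at *; omega)
      rw [← h1, ← h2]; congr 1; omega

theorem fibPeriod_fib_two_mul (j : ℕ) :
    FibPeriod (Nat.fib (j + 1)) (2 * Nat.fib (j + 1) - 1) := by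
  rcases j with _ | j
  · intro i hi; simp at hi
  · refine (fibPeriod_fib (by omega)).mono ?_
    have e1 := Nat.fib_add_two (n := j + 1)
    have e2 := Nat.fib_add_two (n := j + 2)
    have p1 : 0 < Nat.fib (j + 1) := Nat.fib_pos.2 (by omega)
    simp only [add_assoc, Nat.reduceAdd] at *
    omega

/-- The recursion for `ZFib`. -/
theorem zFib_eq_zFib_sub_add_one {n j : ℕ} (hn : 1 ≤ n) (h1 : 2 * Nat.fib j ≤ n)
    (h2 : n < 2 * Nat.fib (j + 1)) :
    Nat.fib (j + 1) ≤ n ∧ zFib n = zFib (n - Nat.fib (j + 1)) + 1 := by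
  have hle : Nat.fib (j + 1) ≤ n := by
    rcases j with _ | j
    · simpa using hn
    · have := Nat.fib_add_two (n := j)
      have := Nat.fib_mono (show j ≤ j + 1 by omega)
      simp only [add_assoc, Nat.reduceAdd] at *
      omega
  refine ⟨hle, zFib_eq_of_longest (by omega) ?_ fun l hl hp => ?_⟩
  · rw [Nat.sub_sub_self hle]
    exact (fibPeriod_fib_two_mul j).mono (by omega)
  · by_contra hlt
    rcases j with _ | j
    · simp at hlt h2; omega
    have hsq : FibPeriod (Nat.fib (j + 1)) (2 * Nat.fib (j + 1) - 1) := fibPeriod_fib_two_mul j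
    have e1 : Nat.fib (j + 1 + 1) = Nat.fib j + Nat.fib (j + 1) := Nat.fib_add_two
    -- The level is now `j + 1`. The period `n - l` lies strictly between `fib (j + 1)` and `fib (j
    -- + 2)`; taking away the period `fib (j + 1)` leaves a period of the first `fib (j + 1) - 1`
    -- letters smaller than `fib j`.
    refine not_fibPeriod_of_lt (j := j) (r := n - l - Nat.fib (j + 1)) (by omega) (by omega)
      fun i hi => ?_
    have h3 := hp i (by omega)
    have h4 := hsq (i + (n - l - Nat.fib (j + 1))) (by omega)
    rw [← h3, ← h4]; congr 1; omega

/-! ### Registers and basic programs -/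

/-- The names of the registers. -/
inductive Reg
  | n | m | w | zero | one | t | k | fa | fb | acc | u | d | a0 | b0 | L | x | r
  | ones | C | p | lim | i | q | a | b | qa | sa | qb | sb | hi | lo | e | f
  deriving DecidableEq

/-- The numbering of the registers; the register `n` has the number `0`. -/
def Reg.toFin (r : Reg) : Fin 33 :=
  ⟨r.ctorIdx, by cases r <;> decide⟩

theorem Reg.toFin_injective : Function.Injective Reg.toFin := by
  intro r s h
  have h' : r.ctorIdx = s.ctorIdx := congrArg Fin.val h
  cases r <;> cases s <;> first | rfl | (simp [Reg.ctorIdx] at h')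

open Stmt Reg

/-! ### Finding levels and computing one value. -/

/-- Move down in the sequence of pairs of adjacent Fibonacci numbers until `2 * fa ≤ k`;
the register `t` holds `2 * fa`. -/
def descendLevel : Stmt Reg :=
  loop k t (sub t fb fa ;; copy fb fa ;; copy fa t ;; add t fa fa)

/-- Add `u` times the Zimin type of the prefix of length `k` to `acc`. -/
def descend : Stmt Reg :=
  loop zero k (add t fa fa ;; descendLevel ;; sub k k fb ;; add acc acc u)

theorem descendLevel_wp {cap : ℕ} {σ : RamState Reg} {j : ℕ} (ha : σ.reg fa = Nat.fib j)
    (hb : σ.reg fb = Nat.fib (j + 1)) (ht : σ.reg t = 2 * Nat.fib j) (hcap : 2 * Nat.fib j ≤ cap)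
    (hk : σ.reg k < 2 * Nat.fib (j + 1)) :
    wp cap descendLevel σ fun σ' => ∃ j' ≤ j, σ'.reg fa = Nat.fib j' ∧
      σ'.reg fb = Nat.fib (j' + 1) ∧ 2 * Nat.fib j' ≤ σ.reg k ∧
      σ.reg k < 2 * Nat.fib (j' + 1) ∧ σ'.time + 6 * j' ≤ σ.time + 6 * j + 2 := by
  refine wp_loop (fun τ => ∃ j' ≤ j, τ.reg fa = Nat.fib j' ∧
      τ.reg fb = Nat.fib (j' + 1) ∧ τ.reg t = 2 * Nat.fib j' ∧
      σ.reg k < 2 * Nat.fib (j' + 1) ∧ τ.time + 6 * j' ≤ σ.time + 6 * j)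
    -- Neither register alone is a strictly decreasing measure, since `fib 1 = fib 2`.
    (fun τ => τ.reg fa + τ.reg fb) ⟨j, le_rfl, ha, hb, ht, hk, le_rfl⟩ ?_ ?_
  · rintro τ hf ⟨j', hj, ha', hb', ht', hk', htime⟩ hlt
    rw [hf.reg k (by decide), ht'] at hlt
    rcases j' with _ | j'
    · simp at hlt
    have e : Nat.fib (j' + 1 + 1) = Nat.fib j' + Nat.fib (j' + 1) := Nat.fib_add_two
    have hm : Nat.fib (j' + 1) ≤ Nat.fib j := Nat.fib_mono hj
    have hm' : Nat.fib j' ≤ Nat.fib (j' + 1) := Nat.fib_le_fib_succ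
    simp only [wp_seq, wp_sub, wp_copy, wp_add]
    refine ⟨?_, ?_, ⟨j', by omega, ?_, ?_, ?_, hlt, ?_⟩, ?_⟩ <;> simp [ha', hb'] <;> omega
  · rintro τ hf ⟨j', hj, ha', hb', ht', hk', htime⟩ hlt
    rw [hf.reg k (by decide), ht'] at hlt
    exact ⟨j', hj, ha', hb', by omega, hk', by simp; omega⟩

/-- After a subtraction the bound `k < 2 * fib (j + 1)` persists, so the level only sinks; the
potential `6 * j + 7 * zFib k` pays for the level changes and the rounds. The factor `u` will place
a digit in a packed cell. -/
theorem descend_wp {cap : ℕ} {σ : RamState Reg} {j : ℕ} (hz : σ.reg zero = 0)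
    (ha : σ.reg fa = Nat.fib j) (hb : σ.reg fb = Nat.fib (j + 1)) (hcap : 2 * Nat.fib j ≤ cap)
    (hk : σ.reg k < 2 * Nat.fib (j + 1))
    (hacc : σ.reg acc + zFib (σ.reg k) * σ.reg u ≤ cap) :
    wp cap descend σ fun σ' => σ'.reg acc = σ.reg acc + zFib (σ.reg k) * σ.reg u ∧
      σ'.time ≤ σ.time + 6 * j + 7 * zFib (σ.reg k) + 2 := by
  refine wp_loop (fun τ => ∃ j' ≤ j, τ.reg fa = Nat.fib j' ∧
      τ.reg fb = Nat.fib (j' + 1) ∧ τ.reg k < 2 * Nat.fib (j' + 1) ∧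
      τ.reg acc + zFib (τ.reg k) * σ.reg u = σ.reg acc + zFib (σ.reg k) * σ.reg u ∧
      τ.time + 6 * j' + 7 * zFib (τ.reg k) ≤ σ.time + 6 * j + 7 * zFib (σ.reg k))
    (fun τ => τ.reg k) ⟨j, le_rfl, ha, hb, hk, rfl, le_rfl⟩ ?_ ?_
  · rintro τ hf ⟨j', hj, ha', hb', hk', hacc', htime⟩ hlt
    rw [hf.reg zero (by decide), hz] at hlt
    have hu : τ.reg u = σ.reg u := hf.reg u (by decide)
    have hm : Nat.fib j' ≤ Nat.fib j := Nat.fib_mono hj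
    simp only [wp_seq, wp_add, RamState.tick_reg, ha']
    refine ⟨by omega, ?_⟩
    refine (descendLevel_wp (j := j') (by simp [ha']) (by simp [hb']) (by simp; omega) (by omega)
      (by simpa using hk')).mono ?_
    rintro σ₁ hf₁ ⟨j'', hj'', ha₁, hb₁, hk₁, hk₁', ht₁⟩
    have h1 := hf₁.reg k (by decide)
    have h2 := hf₁.reg acc (by decide)
    have h3 := hf₁.reg u (by decide)
    simp at h1 h2 h3 hk₁ hk₁' ht₁
    obtain ⟨h4, h5⟩ := zFib_eq_zFib_sub_add_one hlt hk₁ hk₁'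
    have h6 : 0 < Nat.fib (j'' + 1) := Nat.fib_pos.2 (by omega)
    rw [h5, add_mul, one_mul] at hacc'
    simp only [wp_sub]
    refine ⟨?_, ?_, ⟨j'', by omega, ?_, ?_, ?_, ?_, ?_⟩, ?_⟩ <;>
      simp [ha₁, hb₁, h1, h2, h3, hu] <;> omega
  · rintro τ hf ⟨j', hj, ha', hb', hk', hacc', htime⟩ hlt
    rw [hf.reg zero (by decide), hz, Nat.not_lt, Nat.le_zero] at hlt
    simp only [hlt, zFib_zero] at hacc' htime
    simp
    omega

/-- Find the adjacent Fibonacci numbers `fa`, `fb` with `2 * fa ≤ n < 2 * fb`. -/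
def ascend : Stmt Reg :=
  const one 1 ;; const fb 1 ;; copy t n ;;
    loop fb t (add t fa fb ;; copy fa fb ;; copy fb t ;; sub t n fb ;; add t t one)

/-- At each test `t = N + 1 - fb`, so `fb < t` means `2 * fb ≤ N`; the double itself could exceed
the capacity. -/
theorem ascend_wp {N : ℕ} {σ : RamState Reg} (hN : 1 ≤ N) (hn : σ.reg n = N)
    (ha : σ.reg fa = 0) :
    wp N ascend σ fun σ' => ∃ j, σ'.reg fa = Nat.fib j ∧ σ'.reg fb = Nat.fib (j + 1) ∧
      2 * Nat.fib j ≤ N ∧ N < 2 * Nat.fib (j + 1) ∧ Nat.fib (j + 1) ≤ N ∧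
      σ'.reg one = 1 ∧ σ'.time ≤ σ.time + 7 * j + 5 := by
  simp only [ascend, wp_seq, wp_const, wp_copy]
  refine ⟨hN, hN, ?_⟩
  refine wp_loop (fun τ => ∃ j, τ.reg fa = Nat.fib j ∧ τ.reg fb = Nat.fib (j + 1) ∧
      2 * Nat.fib j ≤ N ∧ Nat.fib (j + 1) ≤ N ∧ τ.reg t + Nat.fib (j + 1) = N + 1 ∧
      τ.time ≤ σ.time + 7 * j + 3) (fun τ => τ.reg t - τ.reg fa)
    ⟨0, by simp [ha], by simp, by simp, by simpa using hN, by simp [hn], by simp⟩ ?_ ?_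
  · rintro τ hf ⟨j, ha', hb', h1, h2, h3, h4⟩ hlt
    rw [hb'] at hlt
    have hn' : τ.reg n = N := by rw [hf.reg n (by decide)]; simpa using hn
    have ho : τ.reg one = 1 := by rw [hf.reg one (by decide)]; simp
    have e : Nat.fib (j + 1 + 1) = Nat.fib j + Nat.fib (j + 1) := Nat.fib_add_two
    have hm : Nat.fib j ≤ Nat.fib (j + 1) := Nat.fib_le_fib_succ
    have hp : 0 < Nat.fib (j + 1) := Nat.fib_pos.2 (by omega)
    simp only [wp_seq, wp_sub, wp_copy, wp_add]
    refine ⟨?_, ?_, ?_, ⟨j + 1, ?_, ?_, by omega, by omega, ?_, ?_⟩, ?_⟩ <;>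
      simp [ha', hb', hn', ho] <;> omega
  · rintro τ hf ⟨j, ha', hb', h1, h2, h3, h4⟩ hlt
    rw [hb'] at hlt
    refine ⟨j, ha', hb', h1, by omega, h2, ?_, by simp; omega⟩
    simp only [RamState.tick_reg]
    rw [hf.reg one (by decide)]; simp

/-- The program for a single value of `ZFib`. -/
def singleProgram : Stmt Reg :=
  ascend ;; copy k n ;; copy u one ;; descend ;; copy n acc

/-- Fibonacci numbers at least double every two steps; this bounds the number of levels. -/
theorem le_two_mul_log_fib (j : ℕ) : j ≤ 2 * Nat.log 2 (Nat.fib (j + 1)) + 2 := by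
  have key : ∀ i, 2 ^ i ≤ Nat.fib (2 * i + 1) := by
    intro i
    induction i with
    | zero => simp
    | succ i ih =>
      have e1 : Nat.fib (2 * (i + 1) + 1) = Nat.fib (2 * i + 1) + Nat.fib (2 * i + 2) :=
        Nat.fib_add_two
      have e2 : Nat.fib (2 * i + 1) ≤ Nat.fib (2 * i + 2) := Nat.fib_le_fib_succ
      rw [pow_succ]; omega
  have h1 := (key (j / 2)).trans (Nat.fib_mono (show 2 * (j / 2) + 1 ≤ j + 1 by omega))
  have h2 := (Nat.le_log_iff_pow_le one_lt_two (Nat.fib_pos.2 (by omega)).ne').2 h1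
  omega

theorem zFib_le_log (n : ℕ) : zFib n ≤ Nat.log 2 n + 1 := by
  have h1 : 2 ^ zFib n ≤ 2 ^ (Nat.log 2 n + 1) :=
    (two_pow_zFib_le n).trans (Nat.lt_pow_succ_log_self one_lt_two n)
  exact (Nat.pow_le_pow_iff_right one_lt_two).1 h1

theorem singleProgram_wp {N : ℕ} (hN : 1 ≤ N) :
    wp N singleProgram ⟨fun r => if r = n then N else 0, fun _ => 0, 0⟩ fun σ =>
      σ.reg n = zFib N ∧ σ.time ≤ 33 * Nat.log 2 N + 60 := by
  simp only [singleProgram, wp_seq, wp_copy]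
  refine (ascend_wp hN (by simp) (by simp)).mono ?_
  rintro σ hf ⟨j, ha, hb, h1, h2, h3, ho, ht⟩
  have hz : σ.reg zero = 0 := by rw [hf.reg zero (by decide)]; simp
  have hacc : σ.reg acc = 0 := by rw [hf.reg acc (by decide)]; simp
  have hn : σ.reg n = N := by rw [hf.reg n (by decide)]; simp
  have hlt : zFib N < 2 ^ zFib N := Nat.lt_two_pow_self
  have hle := two_pow_zFib_le N
  refine (descend_wp (j := j) (by simpa) (by simpa) (by simpa) h1 (by simpa [hn])
    (by simp [hacc, hn, ho]; omega)).mono ?_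
  rintro σ' hf' ⟨h4, h5⟩
  simp [hacc, hn, ho] at h4 h5 ht ⊢
  have h6 := zFib_le_log N
  have h7 := le_two_mul_log_fib j
  have h8 : Nat.log 2 (Nat.fib (j + 1)) ≤ Nat.log 2 N := Nat.log_mono_right h3
  omega

/-! ### Space of programs without memory access -/

/-- An instruction that does not access the memory. -/
def Instr.noMem {K : ℕ} : Instr K → Bool
  | .load _ _ => false
  | .store _ _ => false
  | _ => true

theorem Config.exec_noMem {K cap : ℕ} {c c' : Config K} {i : Instr K} (hi : i.noMem = true)
    (hc : (∀ r, c.reg r ≤ cap) ∧ c.used = 0) (h : c.exec cap i = some c') :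
    (∀ r, c'.reg r ≤ cap) ∧ c'.used = 0 := by
  have hw : ∀ d v, c.write cap d v = some c' → (∀ r, c'.reg r ≤ cap) ∧ c'.used = 0 := by
    intro d v hv
    rw [Config.write] at hv
    split_ifs at hv with hcap
    cases hv
    refine ⟨fun r => ?_, hc.2⟩
    simp only [Function.update_apply]
    split_ifs
    exacts [hcap, hc.1 r]
  cases i with
  | const | copy | add => exact hw _ _ h
  | sub =>
    rw [Config.exec] at h
    split_ifs at h
    exact hw _ _ h
  | load | store => simp [Instr.noMem] at hi
  | jump | jumpLt => cases h; exact hc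

/-- As long as `used` stays 0, the space is that of the registers alone. -/
theorem Program.run_noMem {K cap : ℕ} {P : Program K} (hP : ∀ i ∈ P, i.noMem = true) (s : ℕ)
    {c c' : Config K} (hc : (∀ r, c.reg r ≤ cap) ∧ c.used = 0) (h : P.run cap s c = some c') :
    (∀ r, c'.reg r ≤ cap) ∧ c'.used = 0 := by
  induction s generalizing c with
  | zero => cases h; exact hc
  | succ s ih =>
    rw [Program.run, Option.bind_eq_some_iff] at h
    obtain ⟨i, hi, h⟩ := h
    rw [Option.bind_eq_some_iff] at h
    obtain ⟨c₁, h1, h2⟩ := h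
    exact ih (Config.exec_noMem (hP i (List.mem_of_getElem? hi)) hc h1) h2

theorem Config.space_le {K cap : ℕ} (hcap : 1 ≤ cap) {c : Config K}
    (hc : (∀ r, c.reg r ≤ cap) ∧ c.used = 0) : c.space ≤ K * Nat.size cap := by
  rw [Config.space, hc.2, Finset.range_zero, Finset.sum_empty, add_zero]
  calc ∑ r, max 1 (Nat.size (c.reg r)) ≤ ∑ _r : Fin K, Nat.size cap :=
        Finset.sum_le_sum fun r _ => max_le (Nat.size_pos.2 hcap) (Nat.size_le_size (hc.1 r))
    _ = K * Nat.size cap := by simp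

theorem size_le_log_add_one (n : ℕ) : Nat.size n ≤ Nat.log 2 n + 1 :=
  Nat.size_le.2 (Nat.lt_pow_succ_log_self one_lt_two n)

/-! ### Logarithmic bounds and the first claim. -/

open Asymptotics Filter

theorem isBigO_natLog : (fun n : ℕ => (Nat.log 2 n : ℝ)) =O[atTop] fun n : ℕ => Real.log n := by
  refine IsBigO.of_bound (Real.log 2)⁻¹ (Eventually.of_forall fun n => ?_)
  have h := Real.natLog_le_logb n 2
  rw [Real.logb, Nat.cast_ofNat, div_eq_inv_mul] at h
  rw [Real.norm_of_nonneg (Nat.cast_nonneg _), Real.norm_of_nonneg (Real.log_natCast_nonneg n)]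
  exact h

theorem isBigO_const_log (c : ℝ) : (fun _ : ℕ => c) =O[atTop] fun n : ℕ => Real.log n :=
  ((Real.isLittleO_const_log_atTop (c := c)).comp_tendsto tendsto_natCast_atTop_atTop).isBigO

theorem zFib_single_value :
    ∃ (k : ℕ) (P : Program (k + 1)) (T S : ℕ → ℕ),
      (fun n : ℕ => (T n : ℝ)) =O[Filter.atTop] (fun n : ℕ => Real.log n) ∧
      (fun n : ℕ => (S n : ℝ)) =O[Filter.atTop] (fun n : ℕ => Real.log n) ∧
      ∀ n : ℕ, 1 ≤ n → ∃ (t : ℕ) (c : Config (k + 1)),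
        P.HaltsAfter n (Config.init (k + 1) n) t c ∧
        c.reg 0 = zFib n ∧
        t ≤ T n ∧
        ∀ s ≤ t, ∀ c' : Config (k + 1),
          P.run n s (Config.init (k + 1) n) = some c' → c'.space ≤ S n := by
  refine ⟨32, singleProgram.compile Reg.toFin 0, fun n => 33 * Nat.log 2 n + 60,
    fun n => 33 * (Nat.log 2 n + 1), ?_, ?_, fun n hn => ?_⟩
  · push_cast
    exact (isBigO_natLog.const_mul_left 33).add (isBigO_const_log 60)
  · push_cast
    exact (isBigO_natLog.add (isBigO_const_log 1)).const_mul_left 33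
  · obtain ⟨t, c, σ, h1, ⟨h2, h3⟩, h4, h5, -⟩ :=
      wp.haltsAfter Reg.toFin_injective (r₀ := Reg.n) rfl (singleProgram_wp hn)
    refine ⟨t, c, h1, (h5 Reg.n).trans h2, h4.trans_le h3, fun s _ c' hc' => ?_⟩
    -- The compiled program is one concrete list, so the absence of memory instructions is
    -- decidable.
    have := Program.run_noMem (cap := n) (P := singleProgram.compile Reg.toFin 0) (by decide) s
      ⟨fun r => by rw [Config.init]; dsimp only; split_ifs; exacts [le_rfl, Nat.zero_le _], rfl⟩ hc'
    exact (Config.space_le hn this).trans (Nat.mul_le_mul_left _ (size_le_log_add_one n))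

/-! ### Packed cells -/

/-- The number with the `k` digits `g s, g (s + 1), …` to the base `B`, lowest digit first. -/
def pack (B : ℕ) (g : ℕ → ℕ) (s k : ℕ) : ℕ :=
  ∑ i ∈ Finset.range k, g (s + i) * B ^ i

@[simp] theorem pack_zero (B : ℕ) (g : ℕ → ℕ) (s : ℕ) : pack B g s 0 = 0 := by simp [pack]

theorem pack_succ (B : ℕ) (g : ℕ → ℕ) (s k : ℕ) :
    pack B g s (k + 1) = pack B g s k + g (s + k) * B ^ k := by
  simp [pack, Finset.sum_range_succ]

theorem pack_add (B : ℕ) (g : ℕ → ℕ) (s k l : ℕ) :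
    pack B g s (k + l) = pack B g s k + B ^ k * pack B g (s + k) l := by
  rw [pack, Finset.sum_range_add, pack, pack, Finset.mul_sum]
  congr 1
  refine Finset.sum_congr rfl fun i _ => ?_
  rw [pow_add, Nat.add_assoc]; ring

theorem pack_add_fun (B : ℕ) (g h : ℕ → ℕ) (s k : ℕ) :
    pack B (fun i => g i + h i) s k = pack B g s k + pack B h s k := by
  simp [pack, add_mul, Finset.sum_add_distrib]

theorem pack_congr {B : ℕ} {g h : ℕ → ℕ} {s s' k : ℕ} (H : ∀ i < k, g (s + i) = h (s' + i)) :
    pack B g s k = pack B h s' k :=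
  Finset.sum_congr rfl fun i hi => by rw [H i (Finset.mem_range.1 hi)]

theorem pack_lt {B : ℕ} {g : ℕ → ℕ} {s k : ℕ} (h : ∀ i < k, g (s + i) < B) :
    pack B g s k < B ^ k := by
  induction k with
  | zero => simp
  | succ k ih =>
    have h1 := ih fun i hi => h i (by omega)
    have h2 : (g (s + k) + 1) * B ^ k ≤ B * B ^ k := Nat.mul_le_mul_right _ (h k (by omega))
    rw [pack_succ, pow_succ, Nat.mul_comm _ B]
    rw [add_mul, one_mul] at h2
    omega

theorem pack_div {B : ℕ} {g : ℕ → ℕ} {s k l : ℕ} (h : ∀ i < k, g (s + i) < B) :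
    pack B g s (k + l) / B ^ k = pack B g (s + k) l := by
  have h1 := pack_lt h
  rw [pack_add, Nat.add_mul_div_left _ _ (by omega), Nat.div_eq_of_lt h1, zero_add]

theorem pack_mod {B : ℕ} {g : ℕ → ℕ} {s k l : ℕ} (h : ∀ i < k, g (s + i) < B) :
    pack B g s (k + l) % B ^ k = pack B g s k := by
  rw [pack_add, Nat.add_mul_mod_self_left, Nat.mod_eq_of_lt (pack_lt h)]

theorem pack_digit {B : ℕ} {g : ℕ → ℕ} {s k i : ℕ} (h : ∀ i < k, g (s + i) < B) (hi : i < k) :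
    pack B g s k / B ^ i % B = g (s + i) := by
  obtain ⟨l, rfl⟩ := Nat.exists_eq_add_of_lt hi
  rw [Nat.add_assoc, pack_div fun i hi => h i (by omega), Nat.add_comm l 1]
  have h1 := pack_mod (g := g) (s := s + i) (k := 1) (l := l) (B := B) fun x hx => by
    have := h (i + x) (by omega)
    rwa [← Nat.add_assoc] at this
  rw [pow_one] at h1
  rw [h1]; simp [pack]

/-- The `c`-th cell of the packed array `ZFib[1], ZFib[2], …` with `M` digits per cell. -/
noncomputable def zFibCell (B M c : ℕ) : ℕ :=
  pack B (fun i => zFib (i + 1)) (c * M) M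

/-- A cell inside one level of the recursion arises from two adjacent earlier cells. -/
theorem zFibCell_eq {B M Q j qb sb : ℕ} (hM : 2 ≤ M)
    (hB : ∀ i < Q * M, zFib (i + 1) < B) (hf : Nat.fib (j + 1) = qb * M + sb) (hsb : sb < M)
    (h1 : 2 * Nat.fib j ≤ Q * M) (h2 : Q * M + M < 2 * Nat.fib (j + 1)) :
    1 ≤ qb ∧ qb + 1 ≤ Q ∧ zFibCell B M Q =
      zFibCell B M (Q - qb) % B ^ (M - sb) * B ^ sb + zFibCell B M (Q - qb - 1) / B ^ (M - sb) +
        pack B (fun _ => 1) 0 M := by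
  -- If `fib (j + 1) < M`, the upper end of the level forces `Q = 0`, hence `j = 0` and `M < 2`.
  have hqb : 1 ≤ qb := by
    by_contra h
    have : qb = 0 := by omega
    have hQ : Q = 0 := by
      by_contra hQ
      have : 1 * M ≤ Q * M := Nat.mul_le_mul_right _ (by omega)
      simp only [‹qb = 0›] at hf
      omega
    subst this hQ
    simp only [Nat.zero_mul] at hf h1 h2
    have hj : j = 0 := by
      by_contra hj
      have := Nat.fib_pos.2 (Nat.pos_of_ne_zero hj)
      omega
    subst hj
    simp at h2; omega
  have hlt : Nat.fib (j + 1) < Q * M := by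
    -- From level 3 on, `fib (j + 1) < 2 * fib j ≤ Q * M`, so both source cells precede cell `Q`.
    have hj : 3 ≤ j := by
      by_contra hj
      have h3 : j = 0 ∨ j = 1 ∨ j = 2 := by omega
      have h4 : 1 * M ≤ qb * M := Nat.mul_le_mul_right _ hqb
      rcases h3 with rfl | rfl | rfl
      · simp at hf; omega
      · simp at hf; omega
      · simp [Nat.fib_add_two] at hf h1 h2
        omega
    obtain ⟨i, rfl⟩ := Nat.exists_eq_add_of_le' hj
    have e1 : Nat.fib (i + 3 + 1) = Nat.fib (i + 2) + Nat.fib (i + 3) := Nat.fib_add_two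
    have e2 : Nat.fib (i + 3) = Nat.fib (i + 1) + Nat.fib (i + 2) := Nat.fib_add_two
    have : 0 < Nat.fib (i + 1) := Nat.fib_pos.2 (by omega)
    omega
  have hq : qb + 1 ≤ Q := by
    by_contra h
    have : Q * M ≤ qb * M := Nat.mul_le_mul_right _ (by omega)
    omega
  refine ⟨hqb, hq, ?_⟩
  obtain ⟨c, rfl⟩ := Nat.exists_eq_add_of_le hq
  have e1 : qb + 1 + c - qb = c + 1 := by omega
  have e2 : qb + 1 + c - qb - 1 = c := by omega
  rw [e2, e1]
  have em : (qb + 1 + c) * M = c * M + M + qb * M := by ring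
  have em' : (c + 1) * M = c * M + M := by ring
  have em'' : M ≤ qb * M := Nat.le_mul_of_pos_left _ hqb
  rw [em] at hB h1 h2 hlt
  have hsplit : M = (M - sb) + sb := by omega
  have hd : ∀ s, s + M ≤ c * M + M + qb * M → ∀ i < M - sb, zFib (s + i + 1) < B :=
    fun s hs i hi => hB _ (by omega)
  have hmod : zFibCell B M (c + 1) % B ^ (M - sb) =
      pack B (fun i => zFib (i + 1)) (c * M + M) (M - sb) := by
    rw [zFibCell, em']
    have := pack_mod (g := fun i => zFib (i + 1)) (l := sb) (hd (c * M + M) (by omega))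
    rwa [← hsplit] at this
  have hdiv : zFibCell B M c / B ^ (M - sb) =
      pack B (fun i => zFib (i + 1)) (c * M + (M - sb)) sb := by
    rw [zFibCell]
    have := pack_div (g := fun i => zFib (i + 1)) (l := sb) (hd (c * M) (by omega))
    rwa [← hsplit] at this
  -- Lowest digit first, the window consists of the top `sb` digits of cell `c` followed by the low
  -- `M - sb` digits of cell `c + 1`. It starts exactly `fib (j + 1)` places before cell `Q`.
  have hcat : pack B (fun i => zFib (i + 1)) (c * M + M) (M - sb) * B ^ sb +
      pack B (fun i => zFib (i + 1)) (c * M + (M - sb)) sb =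
      pack B (fun i => zFib (i + 1)) (c * M + (M - sb)) M := by
    have := pack_add B (fun i => zFib (i + 1)) (c * M + (M - sb)) sb (M - sb)
    rw [Nat.add_comm sb, ← hsplit, Nat.add_assoc (c * M), ← hsplit] at this
    rw [this]; ring
  have hones : pack B (fun _ => 1) 0 M = pack B (fun _ => 1) (c * M + (M - sb)) M := rfl
  rw [hmod, hdiv, hcat, hones, ← pack_add_fun, zFibCell, em]
  refine pack_congr fun i hi => ?_
  have h3 := (zFib_eq_zFib_sub_add_one (n := c * M + M + qb * M + i + 1) (j := j) (by omega)
    (by omega) (by omega)).2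
  rw [h3]
  congr 2
  omega

/-! ### The parts of the program for the packed array -/

/-- `u := u * 2 ^ w` -/
def shift : Stmt Reg :=
  const d 0 ;; loop d w (add u u u ;; add d d one)

theorem shift_wp {cap W : ℕ} {σ : RamState Reg} (ho : σ.reg one = 1) (hw : σ.reg w = W)
    (hW : W ≤ cap) (hu : σ.reg u * 2 ^ W ≤ cap) :
    wp cap shift σ fun σ' => σ'.reg u = σ.reg u * 2 ^ W ∧ σ'.time ≤ σ.time + 4 * W + 3 := by
  simp only [shift, wp_seq, wp_const]
  refine ⟨Nat.zero_le _, ?_⟩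
  refine wp_loop (fun τ => ∃ i ≤ W, τ.reg d = i ∧ τ.reg u = σ.reg u * 2 ^ i ∧
    τ.time ≤ σ.time + 4 * i + 1) (fun τ => W - τ.reg d) ⟨0, by simp⟩ ?_ ?_
  · rintro τ hf ⟨i, hi, hd, hu', ht⟩ hlt
    have hw' : τ.reg w = W := by rw [hf.reg w (by decide)]; simpa using hw
    have ho' : τ.reg one = 1 := by rw [hf.reg one (by decide)]; simpa using ho
    rw [hd, hw'] at hlt
    have h1 : σ.reg u * 2 ^ (i + 1) ≤ σ.reg u * 2 ^ W :=
      Nat.mul_le_mul_left _ (Nat.pow_le_pow_right two_pos hlt)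
    have h2 : σ.reg u * 2 ^ (i + 1) = σ.reg u * 2 ^ i + σ.reg u * 2 ^ i := by ring
    simp only [wp_seq, wp_add]
    refine ⟨?_, ?_, ⟨i + 1, hlt, ?_, ?_, ?_⟩, ?_⟩ <;> simp [hd, ho', hu'] <;> omega
  · rintro τ hf ⟨i, hi, hd, hu', ht⟩ hlt
    have hw' : τ.reg w = W := by rw [hf.reg w (by decide)]; simpa using hw
    rw [hd, hw'] at hlt
    obtain rfl : i = W := by omega
    exact ⟨hu', by simp; omega⟩

/-- `ones` becomes the number with `m` digits `1` to the base `2 ^ w`, and `C := 2 ^ (w * m)`. -/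
def initPowers : Stmt Reg :=
  const ones 0 ;; const u 1 ;; const i 0 ;;
    loop i m (add ones ones u ;; shift ;; add i i one) ;; copy C u

theorem initPowers_wp {cap W M : ℕ} {σ : RamState Reg} (ho : σ.reg one = 1) (hw : σ.reg w = W)
    (hm : σ.reg m = M) (hW1 : 1 ≤ W) (hW : W ≤ cap) (hM : M ≤ cap) (hu : (2 ^ W) ^ M ≤ cap) :
    wp cap initPowers σ fun σ' => σ'.reg ones = pack (2 ^ W) (fun _ => 1) 0 M ∧
      σ'.reg C = (2 ^ W) ^ M ∧ σ'.time ≤ σ.time + M * (4 * W + 7) + 6 := by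
  have hcap : 1 ≤ cap := hW1.trans hW
  simp only [initPowers, wp_seq, wp_const, wp_copy]
  refine ⟨Nat.zero_le _, hcap, Nat.zero_le _, ?_⟩
  refine wp_loop (fun τ => ∃ k ≤ M, τ.reg i = k ∧ τ.reg u = (2 ^ W) ^ k ∧
    τ.reg ones = pack (2 ^ W) (fun _ => 1) 0 k ∧
    τ.time ≤ σ.time + k * (4 * W + 7) + 3) (fun τ => M - τ.reg i) ⟨0, by simp⟩ ?_ ?_
  · rintro τ hf ⟨k, hk, hi, hu', hones, ht⟩ hlt
    have hw' : τ.reg w = W := by rw [hf.reg w (by decide)]; simpa using hw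
    have hm' : τ.reg m = M := by rw [hf.reg m (by decide)]; simpa using hm
    have ho' : τ.reg one = 1 := by rw [hf.reg one (by decide)]; simpa using ho
    rw [hi, hm'] at hlt
    have h1 : (2 ^ W) ^ (k + 1) ≤ (2 ^ W) ^ M := Nat.pow_le_pow_right (by positivity) hlt
    have h2 : pack (2 ^ W) (fun _ => 1) 0 (k + 1) < (2 ^ W) ^ (k + 1) :=
      pack_lt fun _ _ => Nat.one_lt_two_pow (by omega)
    have h3 : pack (2 ^ W) (fun _ => 1) 0 (k + 1) =
        pack (2 ^ W) (fun _ => 1) 0 k + (2 ^ W) ^ k := by rw [pack_succ, one_mul]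
    simp only [wp_seq, wp_add]
    refine ⟨by simp [hones, hu']; omega, ?_⟩
    refine (shift_wp (W := W) (by simpa) (by simpa) hW
      (by simp [hu', ← pow_succ]; omega)).mono ?_
    rintro σ₁ hf₁ ⟨h4, h5⟩
    have e1 := hf₁.reg i (by decide)
    have e2 := hf₁.reg one (by decide)
    have e3 := hf₁.reg ones (by decide)
    simp [hi, ho', hones, hu', ← pow_succ] at e1 e2 e3 h4 h5
    refine ⟨?_, ⟨k + 1, hlt, ?_, ?_, ?_, ?_⟩, ?_⟩
    · omega
    · simp [e1, e2]
    · simp [h4]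
    · simp [e3, h3]
    · simp [add_mul]; omega
    · simp [e1, e2, hi]; omega
  · rintro τ hf ⟨k, hk, hi, hu', hones, ht⟩ hlt
    have hm' : τ.reg m = M := by rw [hf.reg m (by decide)]; simpa using hm
    rw [hi, hm'] at hlt
    obtain rfl : k = M := by omega
    refine ⟨?_, ?_, ?_⟩ <;> simp [hu', hones]
    omega

/-- `acc` becomes the packed cell with the elements `ZFib[p + 1], …, ZFib[lim]`, computed one
by one. -/
def slowCell : Stmt Reg :=
  const acc 0 ;; const u 1 ;; copy i p ;;
    loop i lim (add i i one ;; copy k i ;; copy fa a0 ;; copy fb b0 ;;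
      descend ;; shift)

/-- The register `u` runs through the powers of the base, so `descend` adds each digit at its own
position. The last shift still has to fit, whence the bound on `(2 ^ W) ^ K`. -/
theorem slowCell_wp {cap W J Z s K : ℕ} {σ : RamState Reg} (hz : σ.reg zero = 0)
    (ho : σ.reg one = 1) (hw : σ.reg w = W) (hW : W ≤ cap) (hcap : 1 ≤ cap)
    (ha : σ.reg a0 = Nat.fib J) (hb : σ.reg b0 = Nat.fib (J + 1)) (hJ : 2 * Nat.fib J ≤ cap)
    (hp : σ.reg p = s) (hl : σ.reg lim = s + K) (hK : s + K ≤ cap)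
    (hKJ : s + K < 2 * Nat.fib (J + 1)) (hu : (2 ^ W) ^ K ≤ cap)
    (hZ : ∀ i ≤ s + K, zFib i ≤ Z) (hZW : Z < 2 ^ W) :
    wp cap slowCell σ fun σ' => σ'.reg acc = pack (2 ^ W) (fun i => zFib (i + 1)) s K ∧
      σ'.time ≤ σ.time + K * (6 * J + 7 * Z + 4 * W + 11) + 5 := by
  simp only [slowCell, wp_seq, wp_const, wp_copy]
  refine ⟨Nat.zero_le _, hcap, ?_⟩
  refine wp_loop (fun τ => ∃ c ≤ K, τ.reg i = s + c ∧ τ.reg u = (2 ^ W) ^ c ∧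
    τ.reg acc = pack (2 ^ W) (fun i => zFib (i + 1)) s c ∧
    τ.time ≤ σ.time + c * (6 * J + 7 * Z + 4 * W + 11) + 3) (fun τ => s + K - τ.reg i)
    ⟨0, by simp [hp]⟩ ?_ ?_
  · rintro τ hf ⟨c, hc, hi, hu', hacc, ht⟩ hlt
    have hz' : τ.reg zero = 0 := by rw [hf.reg zero (by decide)]; simpa using hz
    have hw' : τ.reg w = W := by rw [hf.reg w (by decide)]; simpa using hw
    have ho' : τ.reg one = 1 := by rw [hf.reg one (by decide)]; simpa using ho
    have hl' : τ.reg lim = s + K := by rw [hf.reg lim (by decide)]; simpa using hl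
    have ha' : τ.reg a0 = Nat.fib J := by rw [hf.reg a0 (by decide)]; simpa using ha
    have hb' : τ.reg b0 = Nat.fib (J + 1) := by rw [hf.reg b0 (by decide)]; simpa using hb
    rw [hi, hl'] at hlt
    have hcK : c + 1 ≤ K := by omega
    have h1 : (2 ^ W) ^ (c + 1) ≤ (2 ^ W) ^ K := Nat.pow_le_pow_right (by positivity) hcK
    have hd : ∀ i < c + 1, zFib (s + i + 1) < 2 ^ W := fun i hi =>
      (hZ _ (by omega)).trans_lt hZW
    have h2 := pack_lt (g := fun i => zFib (i + 1)) hd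
    have h3 := pack_succ (2 ^ W) (fun i => zFib (i + 1)) s c
    have h4 : zFib (s + c + 1) ≤ Z := hZ _ (by omega)
    simp only [wp_seq, wp_add, wp_copy]
    refine ⟨by simp [hi, ho']; omega, ?_⟩
    refine (descend_wp (j := J) (by simpa) (by simpa) (by simpa) hJ ?_ ?_).mono ?_
    · simp [hi, ho']; omega
    · simp [hi, ho', hacc, hu']; omega
    rintro σ₁ hf₁ ⟨h5, h6⟩
    have e1 := hf₁.reg i (by decide)
    have e2 := hf₁.reg one (by decide)
    have e3 := hf₁.reg u (by decide)
    have e4 := hf₁.reg w (by decide)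
    simp [hi, ho', hacc, hu', hw', ← h3] at e1 e2 e3 e4 h5 h6
    refine (shift_wp (W := W) e2 e4 hW (by rw [e3, ← pow_succ]; omega)).mono ?_
    rintro σ₂ hf₂ ⟨h7, h8⟩
    have e5 := hf₂.reg i (by decide)
    have e6 := hf₂.reg acc (by decide)
    simp [e1, h5, e3, ← pow_succ] at e5 e6 h7
    refine ⟨⟨c + 1, hcK, ?_, ?_, ?_, ?_⟩, ?_⟩
    · simp [e5]; omega
    · simp [h7]
    · simp [e6]
    · simp [add_mul] at ht ⊢; omega
    · simp [e5, hi]; omega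
  · rintro τ hf ⟨c, hc, hi, hu', hacc, ht⟩ hlt
    have hl' : τ.reg lim = s + K := by rw [hf.reg lim (by decide)]; simpa using hl
    rw [hi, hl'] at hlt
    obtain rfl : c = K := by omega
    exact ⟨hacc, by simp; omega⟩

/-- Move up to the adjacent Fibonacci numbers `a`, `b` with `2 * a ≤ lim < 2 * b`, keeping
track of their quotients and remainders modulo `m`. -/
def advance : Stmt Reg :=
  sub t lim b ;; add t t one ;;
    loop b t (add x a b ;; copy a b ;; copy b x ;;
      add x qa qb ;; copy qa qb ;; copy qb x ;;
      add x sa sb ;; copy sa sb ;; copy sb x ;;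
      ite sb m (copy x x) (sub sb sb m ;; add qb qb one) ;;
      sub t lim b ;; add t t one)

/-- The registers `a`, `b` hold adjacent Fibonacci numbers, and `qa`, `sa`, `qb`, `sb` their
quotients and remainders modulo `M`. -/
structure FibState (M j : ℕ) (τ : RamState Reg) : Prop where
  a : τ.reg a = Nat.fib j
  b : τ.reg b = Nat.fib (j + 1)
  qsa : Nat.fib j = τ.reg qa * M + τ.reg sa
  qsb : Nat.fib (j + 1) = τ.reg qb * M + τ.reg sb
  sa : τ.reg sa < M
  sb : τ.reg sb < M

/-- Quotients and remainders obey the Fibonacci recurrence up to a carry of at most one, because the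
sum of two remainders is below `2 * M`. By `hj` the level rises at least once. -/
theorem advance_wp {cap M P j : ℕ} {σ : RamState Reg} (ho : σ.reg one = 1) (hm : σ.reg m = M)
    (hl : σ.reg lim = P) (hP : P ≤ cap) (hM : 2 * M ≤ cap) (h : FibState M j σ)
    (hj : 2 * Nat.fib (j + 1) ≤ P) :
    wp cap advance σ fun σ' => ∃ j', j < j' ∧ FibState M j' σ' ∧ 2 * Nat.fib j' ≤ P ∧
      P < 2 * Nat.fib (j' + 1) ∧ σ'.time + 17 * j ≤ σ.time + 17 * j' + 4 := by
  have hM0 : 0 < M := (Nat.zero_le _).trans_lt h.sa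
  have hp1 : 0 < Nat.fib (j + 1) := Nat.fib_pos.2 (by omega)
  have hm1 : Nat.fib j ≤ Nat.fib (j + 1) := Nat.fib_le_fib_succ
  simp only [advance, wp_seq, wp_sub, wp_add]
  refine ⟨by simp [hl, h.b]; omega, by simp [hl, h.b, ho]; omega, ?_⟩
  refine wp_loop (fun τ => ∃ j', j ≤ j' ∧ FibState M j' τ ∧ 2 * Nat.fib j' ≤ P ∧
    Nat.fib (j' + 1) ≤ P ∧ τ.reg t + Nat.fib (j' + 1) = P + 1 ∧
    τ.time + 17 * j ≤ σ.time + 17 * j' + 2) (fun τ => 2 * P - τ.reg a - τ.reg b)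
    ⟨j, le_rfl, ⟨by simp [h.a], by simp [h.b], by simpa using h.qsa, by simpa using h.qsb,
      by simpa using h.sa, by simpa using h.sb⟩, by omega, by omega,
      by simp [hl, h.b, ho]; omega, by simp; omega⟩ ?_ ?_
  · rintro τ hf ⟨j', hj', hτ, h1, h2, h3, ht⟩ hlt
    have ho' : τ.reg one = 1 := by rw [hf.reg one (by decide)]; simpa using ho
    have hl' : τ.reg lim = P := by rw [hf.reg lim (by decide)]; simpa using hl
    have hm' : τ.reg m = M := by rw [hf.reg m (by decide)]; simpa using hm
    obtain ⟨ha, hb, hqa, hqb, hsa, hsb⟩ := hτ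
    rw [hb] at hlt
    have e : Nat.fib (j' + 1 + 1) = Nat.fib j' + Nat.fib (j' + 1) := Nat.fib_add_two
    have hp : 0 < Nat.fib (j' + 1) := Nat.fib_pos.2 (by omega)
    have hmm : Nat.fib j' ≤ Nat.fib (j' + 1) := Nat.fib_le_fib_succ
    have hq : Nat.fib (j' + 1 + 1) = (τ.reg qa + τ.reg qb) * M + (τ.reg sa + τ.reg sb) := by
      rw [e, hqa, hqb]; ring
    have hq1 : (τ.reg qa + τ.reg qb) ≤ (τ.reg qa + τ.reg qb) * M :=
      Nat.le_mul_of_pos_right _ hM0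
    simp only [wp_seq, wp_sub, wp_add, wp_copy, wp_ite]
    refine ⟨?_, ?_, ?_, fun hs => ⟨?_, ?_, ⟨j' + 1, by omega, ⟨?_, ?_, ?_, ?_, ?_, ?_⟩, by omega,
      by omega, ?_, ?_⟩, ?_⟩, fun hs => ⟨?_, ?_, ?_, ?_, ⟨j' + 1, by omega,
      ⟨?_, ?_, ?_, ?_, ?_, ?_⟩, by omega, by omega, ?_, ?_⟩, ?_⟩⟩ <;>
      (try simp [ha, hb, hm'] at hs) <;> (try simp [ha, hb, ho', hl', hm']) <;>
      try omega
    have : (τ.reg qa + τ.reg qb + 1) * M = (τ.reg qa + τ.reg qb) * M + M := by ring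
    omega
  · rintro τ hf ⟨j', hj', hτ, h1, h2, h3, ht⟩ hlt
    rw [hτ.b] at hlt
    have hne : j ≠ j' := by rintro rfl; omega
    refine ⟨j', by omega, ⟨hτ.a, hτ.b, hτ.qsa, hτ.qsb, hτ.sa, hτ.sb⟩, h1, by omega, ?_⟩
    simp; omega

/-- `u := 2 ^ (w * sb)` -/
def shiftPower : Stmt Reg :=
  const u 1 ;; const i 0 ;; loop i sb (shift ;; add i i one)

theorem shiftPower_wp {cap W S : ℕ} {σ : RamState Reg} (ho : σ.reg one = 1) (hw : σ.reg w = W)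
    (hs : σ.reg sb = S) (hcap : 1 ≤ cap) (hW : W ≤ cap) (hS : S ≤ cap) (hu : (2 ^ W) ^ S ≤ cap) :
    wp cap shiftPower σ fun σ' => σ'.reg u = (2 ^ W) ^ S ∧
      σ'.time ≤ σ.time + S * (4 * W + 6) + 4 := by
  simp only [shiftPower, wp_seq, wp_const]
  refine ⟨hcap, Nat.zero_le _, ?_⟩
  refine wp_loop (fun τ => ∃ k ≤ S, τ.reg i = k ∧ τ.reg u = (2 ^ W) ^ k ∧
    τ.time ≤ σ.time + k * (4 * W + 6) + 2) (fun τ => S - τ.reg i) ⟨0, by simp⟩ ?_ ?_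
  · rintro τ hf ⟨k, hk, hi, hu', ht⟩ hlt
    have hw' : τ.reg w = W := by rw [hf.reg w (by decide)]; simpa using hw
    have hs' : τ.reg sb = S := by rw [hf.reg sb (by decide)]; simpa using hs
    have ho' : τ.reg one = 1 := by rw [hf.reg one (by decide)]; simpa using ho
    rw [hi, hs'] at hlt
    have h1 : (2 ^ W) ^ (k + 1) ≤ (2 ^ W) ^ S := Nat.pow_le_pow_right (by positivity) hlt
    simp only [wp_seq, wp_add]
    refine (shift_wp (W := W) (by simpa) (by simpa) hW
      (by simp [hu', ← pow_succ]; omega)).mono ?_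
    rintro σ₁ hf₁ ⟨h4, h5⟩
    have e1 := hf₁.reg i (by decide)
    have e2 := hf₁.reg one (by decide)
    simp [hi, ho', hu', ← pow_succ] at e1 e2 h4 h5
    refine ⟨?_, ⟨k + 1, hlt, ?_, ?_, ?_⟩, ?_⟩
    · omega
    · simp [e1, e2]
    · simp [h4]
    · simp [add_mul] at ht ⊢; omega
    · simp [e1, e2, hi]; omega
  · rintro τ hf ⟨k, hk, hi, hu', ht⟩ hlt
    have hs' : τ.reg sb = S := by rw [hf.reg sb (by decide)]; simpa using hs
    rw [hi, hs'] at hlt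
    obtain rfl : k = S := by omega
    exact ⟨by simpa using hu', by simp; omega⟩

/-- The tables of the functions `x ↦ x / U` and `x ↦ (x % U) * V` for `x < C`, where the
register `u` holds `V`, and `C = U * V`. -/
def buildTables : Stmt Reg :=
  const x 0 ;; const hi 0 ;; const lo 0 ;;
    loop x C (store x hi ;; add e x C ;; store e lo ;; add lo lo u ;;
      ite lo C (copy e e) (const lo 0 ;; add hi hi one) ;; add x x one)

/-- No division is needed: `lo` grows by `V` and reaches `U * V` exactly when `x` completes a block
of length `U`; then it restarts at 0 and `hi` counts the block. -/
theorem buildTables_wp {cap U V : ℕ} {σ : RamState Reg} (ho : σ.reg one = 1)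
    (hu : σ.reg u = V) (hC : σ.reg C = U * V) (hU : 0 < U) (hV : 0 < V) (hcap : 2 * (U * V) ≤ cap) :
    wp cap buildTables σ fun σ' => (∀ y < U * V, σ'.mem y = y / U) ∧
      (∀ y < U * V, σ'.mem (U * V + y) = y % U * V) ∧
      (∀ y, 2 * (U * V) ≤ y → σ'.mem y = σ.mem y) ∧
      σ'.time ≤ σ.time + 11 * (U * V) + 5 := by
  have hUV : 0 < U * V := Nat.mul_pos hU hV
  simp only [buildTables, wp_seq, wp_const]
  refine ⟨Nat.zero_le _, Nat.zero_le _, Nat.zero_le _, ?_⟩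
  refine wp_loop (fun τ => ∃ y ≤ U * V, τ.reg x = y ∧ τ.reg hi = y / U ∧ τ.reg lo = y % U * V ∧
    (∀ z < y, τ.mem z = z / U) ∧ (∀ z < y, τ.mem (U * V + z) = z % U * V) ∧
    (∀ z, 2 * (U * V) ≤ z → τ.mem z = σ.mem z) ∧ τ.time ≤ σ.time + 11 * y + 3)
    (fun τ => U * V - τ.reg x) ⟨0, by simp⟩ ?_ ?_
  · rintro τ hf ⟨y, hy, hx, hhi, hlo, hm1, hm2, hm3, ht⟩ hlt
    have ho' : τ.reg one = 1 := by rw [hf.reg one (by decide)]; simpa using ho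
    have hu' : τ.reg u = V := by rw [hf.reg u (by decide)]; simpa using hu
    have hC' : τ.reg C = U * V := by rw [hf.reg C (by decide)]; simpa using hC
    rw [hx, hC'] at hlt
    have hmod : y % U < U := Nat.mod_lt _ hU
    have h1 : y % U * V + V ≤ U * V := by
      rw [← Nat.succ_mul]; exact Nat.mul_le_mul_right _ hmod
    have h2 : y / U ≤ y := Nat.div_le_self _ _
    have h3 : y % U + U * (y / U) = y := Nat.mod_add_div _ _
    have hstep : y % U * V + V < U * V → (y + 1) / U = y / U ∧ (y + 1) % U = y % U + 1 := by
      refine fun hs => (Nat.div_mod_unique hU).2 ⟨by omega, ?_⟩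
      by_contra h
      have : U * V ≤ (y % U + 1) * V := Nat.mul_le_mul_right _ (by omega)
      rw [add_mul] at this; omega
    have hcarry : U * V ≤ y % U * V + V → (y + 1) / U = y / U + 1 ∧ (y + 1) % U = 0 := by
      refine fun hs => (Nat.div_mod_unique hU).2 ⟨?_, hU⟩
      have : ¬ y % U + 1 < U := fun h => by
        have : (y % U + 1 + 1) * V ≤ U * V := Nat.mul_le_mul_right _ h
        rw [add_mul, add_mul] at this; omega
      rw [mul_add]; omega
    have hmem1 : ∀ z ≤ y, (if z = y + U * V then y % U * V else
        if z = y then y / U else τ.mem z) = z / U := by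
      intro z hz
      rw [if_neg (by omega)]
      split_ifs with h
      · rw [h]
      · exact hm1 z (by omega)
    have hmem2 : ∀ z ≤ y, (if U * V + z = y + U * V then y % U * V else
        if U * V + z = y then y / U else τ.mem (U * V + z)) = z % U * V := by
      intro z hz
      split_ifs with h h'
      · rw [show z = y by omega]
      · omega
      · exact hm2 z (by omega)
    have hmem3 : ∀ z, 2 * (U * V) ≤ z → (if z = y + U * V then y % U * V else
        if z = y then y / U else τ.mem z) = σ.mem z := by
      intro z hz
      rw [if_neg (by omega), if_neg (by omega)]
      exact hm3 z hz
    simp only [wp_seq, wp_add, wp_copy, wp_ite, wp_store, wp_const]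
    refine ⟨?_, ?_, fun hs => ⟨?_, ⟨y + 1, hlt, ?_, ?_, ?_, ?_, ?_, ?_, ?_⟩, ?_⟩,
      fun hs => ⟨Nat.zero_le _, ?_, ?_, ⟨y + 1, hlt, ?_, ?_, ?_, ?_, ?_, ?_, ?_⟩, ?_⟩⟩
    · simp [hx, hC']; omega
    · simp [hlo, hu']; omega
    · simp [hx, ho']; omega
    all_goals simp [hx, hC', hlo, hu', hhi, ho'] at hs ⊢
    · exact (hstep hs).1.symm
    · rw [(hstep hs).2, add_mul, one_mul]
    · exact hmem1
    · exact hmem2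
    · exact hmem3
    · omega
    · omega
    · omega
    · omega
    · exact (hcarry hs).1.symm
    · exact Or.inl (hcarry hs).2
    · exact hmem1
    · exact hmem2
    · exact hmem3
    · omega
    · omega
  · rintro τ hf ⟨y, hy, hx, hhi, hlo, hm1, hm2, hm3, ht⟩ hlt
    have hC' : τ.reg C = U * V := by rw [hf.reg C (by decide)]; simpa using hC
    rw [hx, hC'] at hlt
    obtain rfl : y = U * V := by omega
    exact ⟨hm1, hm2, hm3, by simp; omega⟩

/-! ### The main loop -/

/-- The requirements on the parameters of the packed array: `W` bits for a digit, `M` digits in a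
cell, the level `J` of `N` in the Fibonacci sequence, and a bound `Z` on the digits. -/
structure PackParams (N W M J Z : ℕ) : Prop where
  two_le : 2 ≤ M
  one_le : 1 ≤ W
  le_cap : W ≤ N
  memory : 2 * (2 ^ W) ^ M + N / M + 1 ≤ N
  zFib_le : ∀ i ≤ N, zFib i ≤ Z
  lt_pow : Z < 2 ^ W
  fib_le : 2 * Nat.fib J ≤ N
  lt_fib : N < 2 * Nat.fib (J + 1)

theorem PackParams.two_mul_lt {N W M J Z : ℕ} (hP : PackParams N W M J Z) :
    2 * (2 ^ W) ^ M < N := by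
  have := hP.memory
  have := Nat.zero_le (N / M)
  omega

/-- The registers that keep their values during the main loop. -/
structure PackConsts (N W M J : ℕ) (σ : RamState Reg) : Prop where
  zero : σ.reg zero = 0
  one : σ.reg one = 1
  n : σ.reg n = N
  w : σ.reg w = W
  m : σ.reg m = M
  a0 : σ.reg a0 = Nat.fib J
  b0 : σ.reg b0 = Nat.fib (J + 1)
  C : σ.reg C = (2 ^ W) ^ M
  ones : σ.reg ones = pack (2 ^ W) (fun _ => 1) 0 M

theorem PackConsts.congr {N W M J : ℕ} {σ τ : RamState Reg} (h : PackConsts N W M J σ)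
    (H : ∀ r ∈ [Reg.zero, Reg.one, Reg.n, Reg.w, Reg.m, Reg.a0, Reg.b0, Reg.C, Reg.ones],
      τ.reg r = σ.reg r) : PackConsts N W M J τ :=
  ⟨(H _ (by decide)).trans h.zero, (H _ (by decide)).trans h.one, (H _ (by decide)).trans h.n,
    (H _ (by decide)).trans h.w, (H _ (by decide)).trans h.m, (H _ (by decide)).trans h.a0,
    (H _ (by decide)).trans h.b0, (H _ (by decide)).trans h.C, (H _ (by decide)).trans h.ones⟩

theorem PackConsts.frame {N W M J : ℕ} {σ τ : RamState Reg} {s : Stmt Reg}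
    (h : PackConsts N W M J σ) (hf : s.Frame σ τ)
    (hs : ∀ r ∈ [Reg.zero, Reg.one, Reg.n, Reg.w, Reg.m, Reg.a0, Reg.b0, Reg.C, Reg.ones],
      r ∉ s.writes) : PackConsts N W M J τ :=
  h.congr fun r hr => hf.reg r (hs r hr)

theorem FibState.frame {M j : ℕ} {σ τ : RamState Reg} {s : Stmt Reg}
    (h : FibState M j σ) (hf : s.Frame σ τ)
    (hs : ∀ r ∈ [Reg.a, Reg.b, Reg.qa, Reg.sa, Reg.qb, Reg.sb], r ∉ s.writes) :
    FibState M j τ := by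
  have H : ∀ r ∈ [Reg.a, Reg.b, Reg.qa, Reg.sa, Reg.qb, Reg.sb], τ.reg r = σ.reg r :=
    fun r hr => hf.reg r (hs r hr)
  refine ⟨(H _ (by decide)).trans h.a, (H _ (by decide)).trans h.b, ?_, ?_, ?_, ?_⟩
  · rw [H Reg.qa (by decide), H Reg.sa (by decide)]; exact h.qsa
  · rw [H Reg.qb (by decide), H Reg.sb (by decide)]; exact h.qsb
  · rw [H Reg.sa (by decide)]; exact h.sa
  · rw [H Reg.sb (by decide)]; exact h.sb

/-- The tables for the shift by `S` digits are in the cells below `2 * (2 ^ W) ^ M`. -/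
def ShiftTables (W M S : ℕ) (mem : ℕ → ℕ) : Prop :=
  ∀ x < (2 ^ W) ^ M, mem x = x / (2 ^ W) ^ (M - S) ∧
    mem ((2 ^ W) ^ M + x) = x % (2 ^ W) ^ (M - S) * (2 ^ W) ^ S

/-- Compute a cell from two earlier ones. -/
def fastCell : Stmt Reg :=
  sub r q qb ;; load x r ;; add x x C ;; load lo x ;; sub r r one ;; load x r ;; load hi x ;;
    add acc lo hi ;; add acc acc ones ;; store q acc

theorem zFibCell_lt {N W M J Z : ℕ} (hP : PackParams N W M J Z) {c : ℕ} (hc : c * M + M ≤ N) :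
    zFibCell (2 ^ W) M c < (2 ^ W) ^ M :=
  pack_lt fun _ _ => (hP.zFib_le _ (by omega)).trans_lt hP.lt_pow

/-- This is `zFibCell_eq`, with quotient and power products read from the tables. The sums stay
within the capacity since the result is itself a cell below `(2 ^ W) ^ M`. -/
theorem fastCell_wp {N W M J Z Q j : ℕ} {σ : RamState Reg} (hP : PackParams N W M J Z)
    (hσ : PackConsts N W M J σ) (hF : FibState M j σ) (hq : σ.reg q = 2 * (2 ^ W) ^ M + Q)
    (hQ : Q * M + M ≤ N) (h1 : 2 * Nat.fib j ≤ Q * M)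
    (h2 : Q * M + M < 2 * Nat.fib (j + 1))
    (hcells : ∀ c < Q, σ.mem (2 * (2 ^ W) ^ M + c) = zFibCell (2 ^ W) M c)
    (htab : ShiftTables W M (σ.reg sb) σ.mem) :
    wp N fastCell σ fun σ' =>
      (∀ y, σ'.mem y = if y = 2 * (2 ^ W) ^ M + Q then zFibCell (2 ^ W) M Q else σ.mem y) ∧
      σ'.time = σ.time + 10 := by
  obtain ⟨hqb, hqQ, hcell⟩ := zFibCell_eq hP.two_le (B := 2 ^ W)
    (fun i hi => (hP.zFib_le (i + 1) (by omega)).trans_lt hP.lt_pow) hF.qsb hF.sb h1 h2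
  have hlt : ∀ c ≤ Q, zFibCell (2 ^ W) M c < (2 ^ W) ^ M := fun c hc =>
    zFibCell_lt hP (by have := Nat.mul_le_mul_right M hc; omega)
  have hC := hP.two_mul_lt
  have e1 : 2 * (2 ^ W) ^ M + Q - σ.reg qb = 2 * (2 ^ W) ^ M + (Q - σ.reg qb) := by omega
  have e2 : 2 * (2 ^ W) ^ M + (Q - σ.reg qb) - 1 = 2 * (2 ^ W) ^ M + (Q - σ.reg qb - 1) := by
    omega
  have m1 := hcells (Q - σ.reg qb) (by omega)
  have m2 := hcells (Q - σ.reg qb - 1) (by omega)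
  have m3 := htab _ (hlt (Q - σ.reg qb) (by omega))
  have m4 := htab _ (hlt (Q - σ.reg qb - 1) (by omega))
  have hltQ := hlt Q le_rfl
  rw [Nat.add_comm] at m3
  simp only [fastCell, wp_seq, wp_sub, wp_load, wp_add, wp_store]
  simp [hq, e1, m1, hσ.C, m3.2, hσ.one, e2, m2,
    m4.1, hσ.ones, ← hcell]
  have := hlt (Q - σ.reg qb) (by omega)
  omega

/-- Compute a cell element by element, and prepare for the next level. -/
def slowStep : Stmt Reg :=
  slowCell ;; store q acc ;; advance ;; shiftPower ;; buildTables

/-- A bound on the time for the preparation of a level. -/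
def levelTime (W M J Z : ℕ) : ℕ :=
  M * (6 * J + 7 * Z + 4 * W + 11) + M * (4 * W + 6) + 11 * (2 ^ W) ^ M + 40

/-- The cell reaches the end of its level, so the shift `sb` changes and the tables are rebuilt. As
the level rises, the cost is charged to the potential `levelTime * j`. -/
theorem slowStep_wp {N W M J Z Q j : ℕ} {σ : RamState Reg} (hP : PackParams N W M J Z)
    (hσ : PackConsts N W M J σ) (hF : FibState M j σ) (hq : σ.reg q = 2 * (2 ^ W) ^ M + Q)
    (hp : σ.reg p = Q * M) (hl : σ.reg lim = Q * M + M)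
    (hQ : Q * M + M ≤ N) (h2 : 2 * Nat.fib (j + 1) ≤ Q * M + M) :
    wp N slowStep σ fun σ' => ∃ j' > j, FibState M j' σ' ∧ 2 * Nat.fib j' ≤ Q * M + M ∧
      Q * M + M < 2 * Nat.fib (j' + 1) ∧ ShiftTables W M (σ'.reg sb) σ'.mem ∧
      (∀ y, 2 * (2 ^ W) ^ M ≤ y →
        σ'.mem y = if y = 2 * (2 ^ W) ^ M + Q then zFibCell (2 ^ W) M Q else σ.mem y) ∧
      σ'.time + levelTime W M J Z * j ≤ σ.time + levelTime W M J Z * j' := by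
  have hC := hP.two_mul_lt
  have hMC : M < (2 ^ W) ^ M := Nat.lt_pow_self (Nat.one_lt_two_pow (by have := hP.one_le; omega))
  simp only [slowStep, wp_seq]
  refine (slowCell_wp (W := W) (J := J) (Z := Z) (s := Q * M) (K := M) hσ.zero hσ.one hσ.w
    hP.le_cap (by omega) hσ.a0 hσ.b0 hP.fib_le hp hl hQ (by have := hP.lt_fib; omega) (by omega)
    (fun i hi => hP.zFib_le i (by omega)) hP.lt_pow).mono ?_
  rintro σ₁ hf₁ ⟨hacc, ht₁⟩
  have hσ₁ := hσ.frame hf₁ (by decide)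
  have hF₁ := hF.frame hf₁ (by decide)
  have hmem₁ : σ₁.mem = σ.mem := hf₁.mem (by decide)
  have hq₁ := (hf₁.reg q (by decide)).trans hq
  have hl₁ := (hf₁.reg lim (by decide)).trans hl
  rw [wp_store, hq₁, hacc, ← zFibCell]
  refine (advance_wp (cap := N)
    (σ := σ₁.setMem (2 * (2 ^ W) ^ M + Q) (zFibCell (2 ^ W) M Q)) (M := M) (P := Q * M + M) (j := j) hσ₁.one hσ₁.m hl₁ hQ (by omega)
    ⟨hF₁.a, hF₁.b, hF₁.qsa, hF₁.qsb, hF₁.sa, hF₁.sb⟩ h2).mono ?_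
  rintro σ₂ hf₂ ⟨j', hj', hF₂, h3, h4, ht₂⟩
  have hσ₂ : PackConsts N W M J σ₂ :=
    PackConsts.frame (σ := σ₁.setMem (2 * (2 ^ W) ^ M + Q) (zFibCell (2 ^ W) M Q))
      (hσ₁.congr fun _ _ => rfl) hf₂ (by decide)
  have hmem₂ := hf₂.mem (by decide)
  have hsb := hF₂.sb
  have hsplit : (2 ^ W) ^ (M - σ₂.reg sb) * (2 ^ W) ^ σ₂.reg sb = (2 ^ W) ^ M := by
    rw [← pow_add, Nat.sub_add_cancel hsb.le]
  have hle : (2 ^ W) ^ σ₂.reg sb ≤ (2 ^ W) ^ M := Nat.pow_le_pow_right (by positivity) hsb.le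
  refine (shiftPower_wp (S := σ₂.reg sb) hσ₂.one hσ₂.w rfl (by omega) hP.le_cap (by omega)
    (by omega)).mono ?_
  rintro σ₃ hf₃ ⟨hu, ht₃⟩
  have hσ₃ := hσ₂.frame hf₃ (by decide)
  have hF₃ := hF₂.frame hf₃ (by decide)
  have hmem₃ : σ₃.mem = σ₂.mem := hf₃.mem (by decide)
  have hsb₃ : σ₃.reg sb = σ₂.reg sb := hf₃.reg sb (by decide)
  refine (buildTables_wp (cap := N) (U := (2 ^ W) ^ (M - σ₂.reg sb)) (V := (2 ^ W) ^ σ₂.reg sb)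
    hσ₃.one hu (hσ₃.C.trans hsplit.symm) (by positivity) (by positivity) (by omega)).mono ?_
  rintro σ₄ hf₄ ⟨hm1, hm2, hm3, ht₄⟩
  rw [hsplit] at hm1 hm2 hm3 ht₄
  have hsb₄ : σ₄.reg sb = σ₂.reg sb := (hf₄.reg sb (by decide)).trans hsb₃
  refine ⟨j', hj', hF₃.frame hf₄ (by decide), h3, h4, fun x hx => ?_, fun y hy => ?_, ?_⟩
  · rw [hsb₄]; exact ⟨hm1 x hx, hm2 x hx⟩
  · rw [hm3 y hy, hmem₃, hmem₂, RamState.setMem_mem, hmem₁]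
  · obtain ⟨i, rfl⟩ := Nat.exists_eq_add_of_lt hj'
    have h5 : σ₂.reg sb * (4 * W + 6) ≤ M * (4 * W + 6) := Nat.mul_le_mul_right _ hsb.le
    have h6 : levelTime W M J Z * (j + i + 1) =
        levelTime W M J Z * j + levelTime W M J Z * i + levelTime W M J Z := by ring
    -- One cell may pass several levels; each additional one costs only a round of `advance`.
    have h7 : 17 * i ≤ levelTime W M J Z * i :=
      Nat.mul_le_mul_right _ (by rw [levelTime]; omega)
    rw [h6]
    simp only [RamState.setMem_time] at ht₂
    have h8 : levelTime W M J Z = M * (6 * J + 7 * Z + 4 * W + 11) + M * (4 * W + 6) +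
      11 * (2 ^ W) ^ M + 40 := rfl
    omega

/-- Fill all cells that are completely used. The register `f` holds `n - m + 1`. -/
def mainLoop : Stmt Reg :=
  loop p f (add lim p m ;; sub t lim b ;; ite t b fastCell slowStep ;; add q q one ;; copy p lim)

/-- The invariant of the main loop after `Q` cells, at the level `j`. -/
structure PackInv (N W M J Q j : ℕ) (τ : RamState Reg) : Prop where
  consts : PackConsts N W M J τ
  fib : FibState M j τ
  p : τ.reg p = Q * M
  q : τ.reg q = 2 * (2 ^ W) ^ M + Q
  le : Q * M ≤ N
  cells : ∀ c < Q, τ.mem (2 * (2 ^ W) ^ M + c) = zFibCell (2 ^ W) M c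
  phase : (Q = 0 ∧ j = 0) ∨ (1 ≤ Q ∧ 2 * Nat.fib j ≤ Q * M ∧ Q * M < 2 * Nat.fib (j + 1) ∧
    ShiftTables W M (τ.reg sb) τ.mem)

/-- Every cell pays 17 units, and every new level pays `levelTime` once. The program tests `lim - b
< b` instead of `lim < 2 * b`, to remain within the capacity. -/
theorem mainLoop_wp {N W M J Z : ℕ} {σ : RamState Reg} (hP : PackParams N W M J Z)
    (hσ : PackInv N W M J 0 0 σ) (hf : σ.reg f = N - M + 1) :
    wp N mainLoop σ fun σ' => ∃ Q j, PackInv N W M J Q j σ' ∧ N < Q * M + M ∧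
      σ'.time ≤ σ.time + 17 * Q + levelTime W M J Z * j + 2 := by
  have hC := hP.two_mul_lt
  have hM2 := hP.two_le
  have hMC : M < (2 ^ W) ^ M := Nat.lt_pow_self (Nat.one_lt_two_pow (by have := hP.one_le; omega))
  refine wp_loop (fun τ => ∃ Q j, PackInv N W M J Q j τ ∧
    τ.time ≤ σ.time + 17 * Q + levelTime W M J Z * j) (fun τ => N - τ.reg p)
    ⟨0, 0, hσ, by simp⟩ ?_ ?_
  · rintro τ hfr ⟨Q, j, h, ht⟩ hlt
    rw [hfr.reg f (by decide), hf, h.p] at hlt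
    have hQ : Q * M + M ≤ N := by omega
    have hQM : (Q + 1) * M = Q * M + M := by ring
    have hmem := hP.memory
    have hQN : Q < N / M := by
      rw [← Nat.add_one_le_iff, Nat.le_div_iff_mul_le (by omega), hQM]; exact hQ
    -- This makes `lim - b` a legal subtraction; for `j ≥ 1` it follows from `fib (j + 1) ≤ 2 * fib
    -- j`.
    have hb : Nat.fib (j + 1) ≤ Q * M + M := by
      rcases h.phase with ⟨rfl, rfl⟩ | ⟨hQ1, h1, h2, -⟩
      · simp; omega
      · rcases j with _ | j
        · have : 1 * M ≤ Q * M := Nat.mul_le_mul_right _ hQ1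
          simp at h2; omega
        · have e : Nat.fib (j + 1 + 1) = Nat.fib j + Nat.fib (j + 1) := Nat.fib_add_two
          have : Nat.fib j ≤ Nat.fib (j + 1) := Nat.fib_le_fib_succ
          omega
    have hσ' : PackConsts N W M J ((τ.tick.set lim (Q * M + M)).set t
        (Q * M + M - Nat.fib (j + 1))).tick := h.consts.congr (by simp)
    have hF' : FibState M j ((τ.tick.set lim (Q * M + M)).set t
        (Q * M + M - Nat.fib (j + 1))).tick :=
      ⟨by simpa using h.fib.a, by simpa using h.fib.b, by simpa using h.fib.qsa,
        by simpa using h.fib.qsb, by simpa using h.fib.sa, by simpa using h.fib.sb⟩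
    simp only [wp_seq, wp_add, wp_sub, wp_copy, wp_ite]
    refine ⟨by simp [h.p, h.consts.m]; omega, by simp [h.p, h.consts.m, h.fib.b]; omega, ?_⟩
    simp only [RamState.set_reg, RamState.tick_reg, h.p, h.consts.m, h.fib.b, reduceCtorEq,
      if_true, if_false]
    refine ⟨fun hs => ?_, fun hs => ?_⟩
    · have hs' : Q * M + M < 2 * Nat.fib (j + 1) := by omega
      -- At the start there are no tables yet, but the first cell always takes the slow branch,
      -- because `M ≥ 2`.
      have hph : 2 * Nat.fib j ≤ Q * M ∧ ShiftTables W M (τ.reg sb) τ.mem := by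
        rcases h.phase with ⟨rfl, rfl⟩ | ⟨-, h1, -, h2⟩
        · simp at hs'; omega
        · exact ⟨h1, h2⟩
      refine (fastCell_wp (Q := Q) hP hσ' hF' (by simpa using h.q) hQ hph.1 hs'
        (by simpa using h.cells) (by simpa using hph.2)).mono ?_
      rintro σ₁ hf₁ ⟨hm1, ht₁⟩
      have hσ₁ := hσ'.frame hf₁ (by decide)
      have hF₁ := hF'.frame hf₁ (by decide)
      have hq₁ := hf₁.reg q (by decide)
      have hl₁ := hf₁.reg lim (by decide)
      have hsb₁ := hf₁.reg sb (by decide)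
      simp [h.q] at hq₁ hl₁ hsb₁ hm1 ht₁
      refine ⟨?_, ⟨Q + 1, j, ⟨hσ₁.congr (by simp), ⟨?_, ?_, ?_, ?_, ?_, ?_⟩, ?_, ?_, ?_, ?_, ?_⟩,
        ?_⟩, ?_⟩
      · rw [hq₁, hσ₁.one]; omega
      · simpa using hF₁.a
      · simpa using hF₁.b
      · simpa using hF₁.qsa
      · simpa using hF₁.qsb
      · simpa using hF₁.sa
      · simpa using hF₁.sb
      · simp [hl₁, hQM]
      · simp [hq₁, hσ₁.one]; omega
      · omega
      · intro c hc
        simp [hm1]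
        split_ifs with hcQ
        · rw [hcQ]
        · exact h.cells c (by omega)
      · refine Or.inr ⟨by omega, by omega, by omega, ?_⟩
        simp [hsb₁]
        intro x hx
        rw [hm1, hm1, if_neg (by omega), if_neg (by omega)]
        exact hph.2 x hx
      · simp; omega
      · simp [hl₁]; omega
    · refine (slowStep_wp (Q := Q) hP hσ' hF' (by simpa using h.q) (by simpa using h.p) (by simp)
        hQ (by omega)).mono ?_
      rintro σ₁ hf₁ ⟨j', hj', hF₁, h1, h2, htab, hm1, ht₁⟩
      have hσ₁ := hσ'.frame hf₁ (by decide)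
      have hq₁ := hf₁.reg q (by decide)
      have hl₁ := hf₁.reg lim (by decide)
      simp [h.q] at hq₁ hl₁ hm1 ht₁
      refine ⟨?_, ⟨Q + 1, j', ⟨hσ₁.congr (by simp), ⟨?_, ?_, ?_, ?_, ?_, ?_⟩, ?_, ?_, ?_, ?_, ?_⟩,
        ?_⟩, ?_⟩
      · simp [hq₁, hσ₁.one]; omega
      · simpa using hF₁.a
      · simpa using hF₁.b
      · simpa using hF₁.qsa
      · simpa using hF₁.qsb
      · simpa using hF₁.sa
      · simpa using hF₁.sb
      · simp [hl₁, hQM]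
      · simp [hq₁, hσ₁.one]; omega
      · omega
      · intro c hc
        simp [hm1]
        split_ifs with hcQ
        · rw [hcQ]
        · exact h.cells c (by omega)
      · exact Or.inr ⟨by omega, by omega, by omega, by simpa using htab⟩
      · simp; omega
      · simp [hl₁]; omega
  · rintro τ hfr ⟨Q, j, h, ht⟩ hlt
    rw [hfr.reg f (by decide), hf, h.p] at hlt
    refine ⟨Q, j, ⟨h.consts.congr fun _ _ => rfl, ⟨h.fib.a, h.fib.b, h.fib.qsa, h.fib.qsb,
      h.fib.sa, h.fib.sb⟩, h.p, h.q, h.le, h.cells, h.phase⟩, by omega, by simp; omega⟩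

/-! ### The program for the packed array -/

/-- The width of the fields. -/
def digitWidth (N : ℕ) : ℕ := Nat.clog 2 (Nat.log 2 N + 1) + 1

/-- The number of fields in a cell. -/
def cellDigits (N : ℕ) : ℕ := (Nat.log 2 N - 1) / (2 * digitWidth N)

/-- `L := Nat.log 2 n` -/
def logLoop : Stmt Reg :=
  const x 1 ;; copy t n ;; loop x t (add x x x ;; add L L one ;; sub t n x ;; add t t one)

theorem logLoop_wp {N : ℕ} {σ : RamState Reg} (hN : 1 ≤ N) (hn : σ.reg n = N)
    (ho : σ.reg one = 1) (hL : σ.reg L = 0) :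
    wp N logLoop σ fun σ' => σ'.reg L = Nat.log 2 N ∧
      σ'.time ≤ σ.time + 6 * Nat.log 2 N + 4 := by
  simp only [logLoop, wp_seq, wp_const, wp_copy]
  refine ⟨hN, ?_⟩
  refine wp_loop (fun τ => ∃ i, τ.reg x = 2 ^ i ∧ τ.reg L = i ∧ 2 ^ i ≤ N ∧
    τ.reg t + 2 ^ i = N + 1 ∧ τ.time ≤ σ.time + 6 * i + 2) (fun τ => τ.reg t)
    ⟨0, by simp, by simpa, by simpa, by simp [hn], by simp⟩ ?_ ?_
  · rintro τ hf ⟨i, hx, hi, h1, h2, ht⟩ hlt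
    have ho' : τ.reg one = 1 := by rw [hf.reg one (by decide)]; simpa using ho
    have hn' : τ.reg n = N := by rw [hf.reg n (by decide)]; simpa using hn
    rw [hx] at hlt
    have h3 : 2 ^ (i + 1) = 2 ^ i + 2 ^ i := by ring
    have h4 : i < 2 ^ i := Nat.lt_two_pow_self
    simp only [wp_seq, wp_add, wp_sub]
    refine ⟨?_, ?_, ?_, ?_, ⟨i + 1, ?_, ?_, by omega, ?_, ?_⟩, ?_⟩ <;>
      simp [hx, hi, ho', hn'] <;> omega
  · rintro τ hf ⟨i, hx, hi, h1, h2, ht⟩ hlt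
    rw [hx] at hlt
    have h3 : 2 ^ (i + 1) = 2 ^ i + 2 ^ i := by ring
    have h5 : Nat.log 2 N = i := Nat.log_eq_of_pow_le_of_lt_pow h1 (by omega)
    rw [h5]
    exact ⟨hi, by simp; omega⟩

/-- `w := digitWidth n` -/
def widthLoop : Stmt Reg :=
  add r L one ;; const x 1 ;; loop x r (add x x x ;; add w w one) ;; add w w one

theorem clog_succ_le (l : ℕ) : Nat.clog 2 (l + 1) ≤ l :=
  Nat.clog_le_of_le_pow Nat.lt_two_pow_self

theorem log_lt_self {N : ℕ} (hN : 1 ≤ N) : Nat.log 2 N < N :=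
  Nat.lt_two_pow_self.trans_le (Nat.pow_log_le_self 2 (by omega))

/-- This keeps the doublings in `widthLoop` and `cellLoop` within the capacity. -/
theorem two_mul_log_le {N : ℕ} (hN : 1 ≤ N) : 2 * Nat.log 2 N ≤ N := by
  refine le_trans ?_ (Nat.pow_log_le_self 2 (by omega))
  generalize Nat.log 2 N = l
  induction l with
  | zero => simp
  | succ l ih =>
    rcases l with _ | l
    · simp
    · have : 2 ^ (l + 1 + 1) = 2 ^ l * 2 + 2 ^ (l + 1) := by ring
      have : 1 ≤ 2 ^ l := Nat.one_le_two_pow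
      omega

theorem widthLoop_wp {N : ℕ} {σ : RamState Reg} (hN : 1 ≤ N) (ho : σ.reg one = 1)
    (hL : σ.reg L = Nat.log 2 N) (hw : σ.reg w = 0) :
    wp N widthLoop σ fun σ' => σ'.reg w = digitWidth N ∧
      σ'.time ≤ σ.time + 4 * Nat.log 2 N + 5 := by
  have h1 := log_lt_self hN
  have h2 := two_mul_log_le hN
  simp only [widthLoop, wp_seq, wp_add, wp_const]
  refine ⟨by omega, hN, ?_⟩
  refine wp_loop (fun τ => ∃ i, τ.reg x = 2 ^ i ∧ τ.reg w = i ∧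
    i ≤ Nat.clog 2 (Nat.log 2 N + 1) ∧ τ.time ≤ σ.time + 4 * i + 2)
    (fun τ => 2 * (Nat.log 2 N + 1) - τ.reg x)
    ⟨0, by simp, by simpa, by simp, by simp⟩ ?_ ?_
  · rintro τ hf ⟨i, hx, hi, h3, ht⟩ hlt
    have ho' : τ.reg one = 1 := by rw [hf.reg one (by decide)]; simpa using ho
    have hr' : τ.reg r = Nat.log 2 N + 1 := by rw [hf.reg r (by decide)]; simp [hL, ho]
    rw [hx, hr'] at hlt
    have h4 : i < Nat.clog 2 (Nat.log 2 N + 1) := (Nat.lt_clog_iff_pow_lt one_lt_two).2 hlt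
    have h5 : 2 ^ (i + 1) = 2 ^ i + 2 ^ i := by ring
    have h6 := clog_succ_le (Nat.log 2 N)
    have h7 : 1 ≤ 2 ^ i := Nat.one_le_two_pow
    simp only [wp_seq, wp_add]
    refine ⟨?_, ?_, ⟨i + 1, ?_, ?_, h4, ?_⟩, ?_⟩ <;> simp [hx, hi, ho'] <;> omega
  · rintro τ hf ⟨i, hx, hi, h3, ht⟩ hlt
    have ho' : τ.reg one = 1 := by rw [hf.reg one (by decide)]; simpa using ho
    have hr' : τ.reg r = Nat.log 2 N + 1 := by rw [hf.reg r (by decide)]; simp [hL, ho]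
    rw [hx, hr'] at hlt
    have h4 : Nat.clog 2 (Nat.log 2 N + 1) ≤ i := Nat.clog_le_of_le_pow (not_lt.1 hlt)
    have h6 := clog_succ_le (Nat.log 2 N)
    rw [digitWidth]
    refine ⟨?_, ?_, ?_⟩ <;> simp [hi, ho'] <;> omega

/-- `m := cellDigits n` -/
def cellLoop : Stmt Reg :=
  ite w L (add x w w ;; copy r L ;; loop x r (sub r r x ;; add m m one)) (copy t t)

/-- The strict test keeps `r ≥ 1`, so repeated subtraction divides `Nat.log 2 N - 1`. If `w < L`
fails, the quotient is 0 and doubling `w`, which might be illegal, is avoided. -/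
theorem cellLoop_wp {N : ℕ} {σ : RamState Reg} (hN : 1 ≤ N) (ho : σ.reg one = 1)
    (hL : σ.reg L = Nat.log 2 N) (hw : σ.reg w = digitWidth N) (hm : σ.reg m = 0) :
    wp N cellLoop σ fun σ' => σ'.reg m = cellDigits N ∧
      σ'.time ≤ σ.time + 4 * Nat.log 2 N + 5 := by
  have h2 := two_mul_log_le hN
  have hW : 1 ≤ digitWidth N := by rw [digitWidth]; omega
  simp only [cellLoop, wp_ite, wp_seq, wp_add, wp_copy, hw, hL]
  refine ⟨fun hlt => ⟨by simp [hw]; omega, ?_⟩, fun hlt => ⟨?_, ?_⟩⟩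
  · refine wp_loop (fun τ => ∃ c l, τ.reg m = c ∧ τ.reg r = l ∧ 1 ≤ l ∧
      l + 2 * digitWidth N * c = Nat.log 2 N ∧ c + l ≤ Nat.log 2 N ∧ τ.time ≤ σ.time + 4 * c + 3)
      (fun τ => τ.reg r)
      ⟨0, Nat.log 2 N, by simpa, by simpa, by omega, by simp, by simp, by simp⟩ ?_ ?_
    · rintro τ hf ⟨c, l, hc, hl, h3, h4, h5, ht⟩ hlt'
      have ho' : τ.reg one = 1 := by rw [hf.reg one (by decide)]; simpa using ho
      have hx' : τ.reg x = 2 * digitWidth N := by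
        rw [hf.reg x (by decide)]; simp [hw]; omega
      rw [hx', hl] at hlt'
      have h6 : 2 * digitWidth N * (c + 1) = 2 * digitWidth N * c + 2 * digitWidth N := by ring
      simp only [wp_seq, wp_add, wp_sub]
      refine ⟨?_, ?_, ⟨c + 1, l - 2 * digitWidth N, ?_, ?_, by omega, by omega, by omega, ?_⟩, ?_⟩
        <;> simp [hc, hl, ho', hx'] <;> omega
    · rintro τ hf ⟨c, l, hc, hl, h3, h4, h5, ht⟩ hlt'
      have hx' : τ.reg x = 2 * digitWidth N := by
        rw [hf.reg x (by decide)]; simp [hw]; omega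
      rw [hx', hl] at hlt'
      have h6 : 2 * digitWidth N * (c + 1) = 2 * digitWidth N * c + 2 * digitWidth N := by ring
      refine ⟨?_, by simp; omega⟩
      rw [RamState.tick_reg, RamState.tick_reg, hc, cellDigits]
      symm
      rw [Nat.div_eq_iff (by omega)]
      have h7 : c * (2 * digitWidth N) = 2 * digitWidth N * c := Nat.mul_comm _ _
      omega
  · rw [cellDigits, Nat.div_eq_of_lt (by omega)]; simpa
  · simp; omega

/-- Compute the parameters of the packed array. -/
def prepare : Stmt Reg :=
  ascend ;; copy a0 fa ;; copy b0 fb ;; logLoop ;; widthLoop ;; cellLoop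

/-- The values of the registers after the preparation. -/
structure Prepared (N J : ℕ) (σ : RamState Reg) : Prop where
  zero : σ.reg zero = 0
  one : σ.reg one = 1
  n : σ.reg n = N
  L : σ.reg L = Nat.log 2 N
  w : σ.reg w = digitWidth N
  m : σ.reg m = cellDigits N
  a0 : σ.reg a0 = Nat.fib J
  b0 : σ.reg b0 = Nat.fib (J + 1)
  fib_le : 2 * Nat.fib J ≤ N
  lt_fib : N < 2 * Nat.fib (J + 1)
  le_log : J ≤ 2 * Nat.log 2 N + 2

theorem prepare_wp {N : ℕ} (hN : 1 ≤ N) :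
    wp N prepare ⟨fun r => if r = n then N else 0, fun _ => 0, 0⟩ fun σ =>
      ∃ J, Prepared N J σ ∧ σ.time ≤ 30 * Nat.log 2 N + 40 := by
  simp only [prepare, wp_seq, wp_copy]
  refine (ascend_wp hN (by simp) (by simp)).mono ?_
  rintro σ₁ hf₁ ⟨J, ha, hb, h1, h2, h3, ho₁, ht₁⟩
  have hn₁ := hf₁.reg n (by decide)
  have hL₁ := hf₁.reg L (by decide)
  have hw₁ := hf₁.reg w (by decide)
  have hm₁ := hf₁.reg m (by decide)
  have hz₁ := hf₁.reg zero (by decide)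
  simp at hn₁ hL₁ hw₁ hm₁ hz₁ ht₁
  refine (logLoop_wp hN (by simpa) (by simpa) (by simpa)).mono ?_
  rintro σ₂ hf₂ ⟨hL₂, ht₂⟩
  have ho₂ := hf₂.reg one (by decide)
  have hw₂ := hf₂.reg w (by decide)
  simp [ho₁, hw₁] at ho₂ hw₂ ht₂
  refine (widthLoop_wp hN ho₂ hL₂ hw₂).mono ?_
  rintro σ₃ hf₃ ⟨hw₃, ht₃⟩
  have hm₃ := (hf₃.reg m (by decide)).trans (hf₂.reg m (by decide))
  simp [hm₁] at hm₃
  have ho₃ := (hf₃.reg one (by decide)).trans ho₂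
  have hL₃ := (hf₃.reg L (by decide)).trans hL₂
  refine (cellLoop_wp hN ho₃ hL₃ hw₃ hm₃).mono ?_
  rintro σ₄ hf₄ ⟨hm₄, ht₄⟩
  have hback : ∀ r ∈ [Reg.zero, Reg.n, Reg.a0, Reg.b0], σ₄.reg r =
      ((σ₁.set a0 (σ₁.reg fa)).set b0 ((σ₁.set a0 (σ₁.reg fa)).reg fb)).reg r := by
    intro r hr
    rw [hf₄.reg r (by revert r; decide), hf₃.reg r (by revert r; decide),
      hf₂.reg r (by revert r; decide)]
  have h4 : J ≤ 2 * Nat.log 2 N + 2 := by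
    have h5 := le_two_mul_log_fib J
    have h6 : Nat.log 2 (Nat.fib (J + 1)) ≤ Nat.log 2 N := Nat.log_mono_right h3
    omega
  refine ⟨J, ⟨?_, (hf₄.reg one (by decide)).trans ho₃, ?_, (hf₄.reg L (by decide)).trans hL₃,
    (hf₄.reg w (by decide)).trans hw₃, hm₄, ?_, ?_, h1, h2, h4⟩, by omega⟩
  · rw [hback _ (by decide)]; simpa using hz₁
  · rw [hback _ (by decide)]; simpa using hn₁
  · rw [hback _ (by decide)]; simpa using ha
  · rw [hback _ (by decide)]; simpa using hb

/-- The array with one element per cell, computed element by element. -/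
def unpackedArray : Stmt Reg :=
  const i 0 ;; const u 1 ;;
    loop i n (add k i one ;; copy fa a0 ;; copy fb b0 ;; const acc 0 ;; descend ;; store i acc ;;
      add i i one) ;;
    add w L one ;; copy m one ;; copy n zero

/-- This serves the `N` whose cells would have fewer than two digits; they are bounded, so the
slower time is harmless. -/
theorem unpackedArray_wp {N J : ℕ} {σ : RamState Reg} (hN : 1 ≤ N) (hσ : Prepared N J σ) :
    wp N unpackedArray σ fun σ' =>
      IsPackedArray σ'.mem (σ'.reg n) (σ'.reg m) (σ'.reg w) N zFib ∧
      σ'.time ≤ σ.time + N * (19 * Nat.log 2 N + 40) + 7 := by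
  have hlog := log_lt_self hN
  simp only [unpackedArray, wp_seq, wp_const, wp_add, wp_copy]
  refine ⟨Nat.zero_le _, hN, ?_⟩
  refine wp_loop (fun τ => ∃ c ≤ N, τ.reg i = c ∧ (∀ y < c, τ.mem y = zFib (y + 1)) ∧
    τ.time ≤ σ.time + c * (19 * Nat.log 2 N + 40) + 2) (fun τ => N - τ.reg i)
    ⟨0, by simp⟩ ?_ ?_
  · rintro τ hf ⟨c, hc, hi, hmem, ht⟩ hlt
    have hn' : τ.reg n = N := by rw [hf.reg n (by decide)]; simpa using hσ.n
    have ho' : τ.reg one = 1 := by rw [hf.reg one (by decide)]; simpa using hσ.one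
    have hz' : τ.reg zero = 0 := by rw [hf.reg zero (by decide)]; simpa using hσ.zero
    have ha' : τ.reg a0 = Nat.fib J := by rw [hf.reg a0 (by decide)]; simpa using hσ.a0
    have hb' : τ.reg b0 = Nat.fib (J + 1) := by rw [hf.reg b0 (by decide)]; simpa using hσ.b0
    have hu' : τ.reg u = 1 := by rw [hf.reg u (by decide)]; simp
    rw [hi, hn'] at hlt
    have h1 := zFib_le_log (c + 1)
    have h2 : Nat.log 2 (c + 1) ≤ Nat.log 2 N := Nat.log_mono_right hlt
    have h3 := hσ.lt_fib
    have h4 := hσ.le_log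
    simp only [wp_seq, wp_add, wp_copy, wp_const, wp_store]
    refine ⟨by simp [hi, ho']; omega, Nat.zero_le _, ?_⟩
    refine (descend_wp (j := J) (by simpa) (by simpa) (by simpa) hσ.fib_le ?_ ?_).mono ?_
    · simp [hi, ho']; omega
    · simp [hi, ho', hu']; omega
    rintro σ₁ hf₁ ⟨h5, h6⟩
    have e1 := hf₁.reg i (by decide)
    have e2 := hf₁.reg one (by decide)
    have e3 := hf₁.mem (by decide)
    simp [hi, ho', hu'] at e1 e2 e3 h5 h6
    refine ⟨?_, ⟨c + 1, hlt, ?_, ?_, ?_⟩, ?_⟩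
    · simp [e1, e2]; omega
    · simp [e1, e2]
    · intro y hy
      simp only [RamState.tick_mem, RamState.set_mem, RamState.setMem_mem, e1, e3, h5]
      split_ifs with h
      · rw [h]
      · exact hmem y (by omega)
    · simp [add_mul] at ht ⊢; omega
    · simp [e1, e2, hi]; omega
  · rintro τ hf ⟨c, hc, hi, hmem, ht⟩ hlt
    have hn' : τ.reg n = N := by rw [hf.reg n (by decide)]; simpa using hσ.n
    have ho' : τ.reg one = 1 := by rw [hf.reg one (by decide)]; simpa using hσ.one
    have hz' : τ.reg zero = 0 := by rw [hf.reg zero (by decide)]; simpa using hσ.zero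
    have hL' : τ.reg L = Nat.log 2 N := by rw [hf.reg L (by decide)]; simpa using hσ.L
    rw [hi, hn'] at hlt
    obtain rfl : c = N := by omega
    simp [hL', ho', hz']
    refine ⟨by omega, ⟨one_pos, fun y hy => ?_⟩, by omega⟩
    rw [Nat.div_one, Nat.zero_add, Nat.mod_one, Nat.mul_zero, pow_zero, Nat.div_one, hmem y hy]
    refine Nat.mod_eq_of_lt ((zFib_le_log (y + 1)).trans_lt ?_)
    have h2 : Nat.log 2 (y + 1) ≤ Nat.log 2 c := Nat.log_mono_right hy
    have h3 : Nat.log 2 c + 1 < 2 ^ (Nat.log 2 c + 1) := Nat.lt_two_pow_self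
    omega

/-- The packed array, computed cell by cell. -/
def packedArray : Stmt Reg :=
  initPowers ;; sub f n m ;; add f f one ;; const p 0 ;; add q C C ;; const a 0 ;; const b 1 ;;
    const qa 0 ;; const sa 0 ;; const qb 0 ;; const sb 1 ;; mainLoop ;;
    copy lim n ;; slowCell ;; store q acc ;; add n C C

/-- The additional bit in `digitWidth` makes the inequality strict, so that the bound `Nat.log 2 N +
1` on ZFib is a digit. -/
theorem lt_two_pow_digitWidth (N : ℕ) : Nat.log 2 N + 1 < 2 ^ digitWidth N := by
  have h := Nat.le_pow_clog one_lt_two (Nat.log 2 N + 1)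
  rw [digitWidth, pow_succ]; omega

theorem digitWidth_mul_cellDigits_le (N : ℕ) :
    2 * (digitWidth N * cellDigits N) ≤ Nat.log 2 N - 1 := by
  rw [← mul_assoc]; exact Nat.mul_div_le _ _

/-- A cell uses at most half of `Nat.log 2 N - 1` bits. Hence a table has at most √N entries, which
makes rebuilding it at every level affordable. -/
theorem cell_mul_self_le {N : ℕ} (hM : 2 ≤ cellDigits N) :
    2 * ((2 ^ digitWidth N) ^ cellDigits N * (2 ^ digitWidth N) ^ cellDigits N) ≤ N := by
  have h1 := digitWidth_mul_cellDigits_le N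
  have hW : 1 ≤ digitWidth N := by rw [digitWidth]; omega
  have h2 : 1 * 2 ≤ digitWidth N * cellDigits N := Nat.mul_le_mul hW hM
  have hN : N ≠ 0 := by
    rintro rfl
    simp at h1
    omega
  refine le_trans ?_ (Nat.pow_log_le_self 2 hN)
  rw [← pow_mul, ← pow_add, ← pow_succ']
  exact Nat.pow_le_pow_right two_pos (by omega)

theorem Prepared.packParams {N J : ℕ} {σ : RamState Reg} (h : Prepared N J σ)
    (hM : 2 ≤ cellDigits N) :
    PackParams N (digitWidth N) (cellDigits N) J (Nat.log 2 N + 1) := by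
  have hW : 1 ≤ digitWidth N := by rw [digitWidth]; omega
  have hC := cell_mul_self_le hM
  have h4 : 4 ≤ (2 ^ digitWidth N) ^ cellDigits N := by
    rw [← pow_mul]
    have h2 : 1 * 2 ≤ digitWidth N * cellDigits N := Nat.mul_le_mul hW hM
    exact (Nat.pow_le_pow_right two_pos h2)
  -- With C ≥ 4 and 2 C² ≤ N, the two tables take at most N / 4 cells and the array about N / 2, so
  -- all addresses are legal.
  have h5 := Nat.mul_le_mul_right ((2 ^ digitWidth N) ^ cellDigits N) h4
  have h6 : N / cellDigits N ≤ N / 2 := Nat.div_le_div_left hM two_pos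
  have h7 := clog_succ_le (Nat.log 2 N)
  have h8 := log_lt_self (N := N) (by omega)
  exact ⟨hM, hW, by rw [digitWidth]; omega, by omega,
    fun i hi => (zFib_le_log i).trans (Nat.succ_le_succ (Nat.log_mono_right hi)),
    lt_two_pow_digitWidth N, h.fib_le, h.lt_fib⟩

/-- A bound on the time of `packedArray`. -/
def packedTime (N : ℕ) : ℕ :=
  17 * (N / cellDigits N) + (11 * (2 ^ digitWidth N) ^ cellDigits N + 70 * (Nat.log 2 N + 1) ^ 2) *
    (2 * Nat.log 2 N + 5)

theorem levelTime_le {N J : ℕ} (hJ : J ≤ 2 * Nat.log 2 N + 2) :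
    levelTime (digitWidth N) (cellDigits N) J (Nat.log 2 N + 1) ≤
      11 * (2 ^ digitWidth N) ^ cellDigits N + 70 * (Nat.log 2 N + 1) ^ 2 := by
  have h1 := digitWidth_mul_cellDigits_le N
  have hM : cellDigits N ≤ digitWidth N * cellDigits N :=
    Nat.le_mul_of_pos_left _ (by rw [digitWidth]; omega)
  rw [levelTime]
  generalize Nat.log 2 N = l at *
  generalize digitWidth N = W at *
  generalize cellDigits N = M at *
  have e1 : M * (6 * J + 7 * (l + 1) + 4 * W + 11) + M * (4 * W + 6) =
      M * (6 * J + 7 * l) + 8 * (W * M) + 24 * M := by ring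
  have h2 : M * (6 * J + 7 * l) ≤ l * (19 * l + 12) := Nat.mul_le_mul (by omega) (by omega)
  have e2 : l * (19 * l + 12) = 19 * (l * l) + 12 * l := by ring
  have e3 : 70 * (l + 1) ^ 2 = 70 * (l * l) + 140 * l + 70 := by ring
  have : 0 ≤ l * l := Nat.zero_le _
  omega

theorem packedArray_wp {N J : ℕ} {σ : RamState Reg} (hσ : Prepared N J σ)
    (hM : 2 ≤ cellDigits N) :
    wp N packedArray σ fun σ' =>
      IsPackedArray σ'.mem (σ'.reg n) (σ'.reg m) (σ'.reg w) N zFib ∧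
      σ'.time ≤ σ.time + packedTime N := by
  have hP := hσ.packParams hM
  have hC := hP.two_mul_lt
  have hlt := levelTime_le hσ.le_log
  have hlog := digitWidth_mul_cellDigits_le N
  have hlev : levelTime (digitWidth N) (cellDigits N) J (Nat.log 2 N + 1) =
    cellDigits N * (6 * J + 7 * (Nat.log 2 N + 1) + 4 * digitWidth N + 11) +
      cellDigits N * (4 * digitWidth N + 6) + 11 * (2 ^ digitWidth N) ^ cellDigits N + 40 := rfl
  have hpt : packedTime N = 17 * (N / cellDigits N) +
    (11 * (2 ^ digitWidth N) ^ cellDigits N + 70 * (Nat.log 2 N + 1) ^ 2) *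
    (2 * Nat.log 2 N + 5) := rfl
  have hw₀ := hσ.w
  have hm₀ := hσ.m
  generalize digitWidth N = W at *
  generalize cellDigits N = M at *
  have hMC : M < (2 ^ W) ^ M := Nat.lt_pow_self (Nat.one_lt_two_pow (by have := hP.one_le; omega))
  simp only [packedArray, wp_seq, wp_const, wp_add, wp_sub, wp_copy, wp_store]
  refine (initPowers_wp (M := M) hσ.one hw₀ hm₀ hP.one_le hP.le_cap (by omega) (by omega)).mono ?_
  rintro σ₁ hf₁ ⟨hones, hCr, ht₁⟩
  have hc₁ : PackConsts N W M J σ₁ :=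
    ⟨(hf₁.reg zero (by decide)).trans hσ.zero, (hf₁.reg one (by decide)).trans hσ.one,
      (hf₁.reg n (by decide)).trans hσ.n, (hf₁.reg w (by decide)).trans hw₀,
      (hf₁.reg m (by decide)).trans hm₀, (hf₁.reg a0 (by decide)).trans hσ.a0,
      (hf₁.reg b0 (by decide)).trans hσ.b0, hCr, hones⟩
  refine ⟨by simp [hc₁.n, hc₁.m]; omega, by simp [hc₁.n, hc₁.m, hc₁.one]; omega, Nat.zero_le _,
    by simp [hCr]; omega, Nat.zero_le _, by omega, Nat.zero_le _, Nat.zero_le _, Nat.zero_le _,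
    by omega, ?_⟩
  refine (mainLoop_wp (W := W) (M := M) (J := J) hP
    ⟨hc₁.congr (by simp), ⟨by simp, by simp, by simp, by simp, by simp; omega, by simp; omega⟩,
      by simp, by simp [hCr]; omega, by simp, by simp, Or.inl ⟨rfl, rfl⟩⟩
    (by simp [hc₁.n, hc₁.m, hc₁.one])).mono ?_
  rintro σ₂ hf₂ ⟨Q, j, hI, hQ, ht₂⟩
  simp at ht₂
  have hle := hI.le
  have hK : N - Q * M ≤ M := by omega
  have hn₂ := hI.consts.n
  have hpow : (2 ^ W) ^ (N - Q * M) ≤ (2 ^ W) ^ M := Nat.pow_le_pow_right (by positivity) hK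
  refine (slowCell_wp (W := W) (J := J) (Z := Nat.log 2 N + 1) (s := Q * M) (K := N - Q * M)
    (by simpa using hI.consts.zero) (by simpa using hI.consts.one) (by simpa using hI.consts.w)
    hP.le_cap (by omega) (by simpa using hI.consts.a0) (by simpa using hI.consts.b0) hP.fib_le
    (by simpa using hI.p) (by simp [hn₂]; omega) (by omega)
    (by have := hP.lt_fib; omega) (by omega) (fun i hi => hP.zFib_le i (by omega)) hP.lt_pow).mono ?_
  rintro σ₃ hf₃ ⟨hacc, ht₃⟩
  have hC₃ := hf₃.reg C (by decide)
  have hq₃ := hf₃.reg q (by decide)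
  have hm₃ := hf₃.reg m (by decide)
  have hw₃ := hf₃.reg w (by decide)
  have hmem₃ := hf₃.mem (by decide)
  simp [hI.consts.C, hI.q, hI.consts.m, hI.consts.w] at hC₃ hq₃ hm₃ hw₃ hmem₃ ht₃
  have hM0 : 0 < M := by omega
  refine ⟨by simp [hC₃]; omega, ⟨by simpa [hm₃], fun y hy => ?_⟩, ?_⟩
  · simp [hm₃, hw₃, hC₃, hq₃, hacc, hmem₃]
    have hy0 : y / M * M + y % M = y := Nat.div_add_mod' y M
    have hymod : y % M < M := Nat.mod_lt _ hM0
    have hdig : ∀ s k, s + k ≤ N → ∀ i < k, zFib (s + i + 1) < 2 ^ W := fun s k hs i hi =>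
      (hP.zFib_le _ (by omega)).trans_lt hP.lt_pow
    rw [pow_mul]
    -- The final, possibly partial cell `Q` was stored after the main loop; all others come from its
    -- invariant.
    split_ifs with h
    · have hyQ : y / M = Q := by omega
      rw [hyQ] at hy0
      rw [pack_digit (g := fun i => zFib (i + 1)) (hdig _ _ (by omega)) (by omega), hy0]
    · have hyQ : y / M < Q := by
        have : y / M < Q + 1 := by
          rw [Nat.div_lt_iff_lt_mul hM0, add_mul]; omega
        omega
      have hc := hI.cells (y / M) hyQ
      have : (y / M + 1) * M ≤ Q * M := Nat.mul_le_mul_right _ hyQ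
      rw [add_mul] at this
      rw [show (2 ^ W) ^ M + (2 ^ W) ^ M + y / M = 2 * (2 ^ W) ^ M + y / M by omega, hc, zFibCell,
        pack_digit (g := fun i => zFib (i + 1)) (hdig _ _ (by omega)) hymod, hy0]
  · have hQN : Q ≤ N / M := by rw [Nat.le_div_iff_mul_le hM0]; exact hle
    have hj : j ≤ 2 * Nat.log 2 N + 2 := by
      have h5 := le_two_mul_log_fib j
      have h6 : Nat.fib (j + 1) ≤ N := by
        rcases hI.phase with ⟨-, rfl⟩ | ⟨-, h1, -, -⟩
        · simp; omega
        · rcases j with _ | j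
          · simp; omega
          · have e : Nat.fib (j + 1 + 1) = Nat.fib j + Nat.fib (j + 1) := Nat.fib_add_two
            have : Nat.fib j ≤ Nat.fib (j + 1) := Nat.fib_le_fib_succ
            omega
      have h7 : Nat.log 2 (Nat.fib (j + 1)) ≤ Nat.log 2 N := Nat.log_mono_right h6
      omega
    have t1 := Nat.mul_le_mul hlt hj
    have t2 := Nat.mul_le_mul_right (6 * J + 7 * (Nat.log 2 N + 1) + 4 * W + 11) hK
    -- The levels use the factor `2 * Nat.log 2 N + 2`; the three remaining shares cover
    -- `initPowers`, the last cell and the constant overhead.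
    have t3 : (11 * (2 ^ W) ^ M + 70 * (Nat.log 2 N + 1) ^ 2) * (2 * Nat.log 2 N + 5) =
      (11 * (2 ^ W) ^ M + 70 * (Nat.log 2 N + 1) ^ 2) * (2 * Nat.log 2 N + 2) +
        3 * (11 * (2 ^ W) ^ M + 70 * (Nat.log 2 N + 1) ^ 2) := by ring
    have t4 : M * (4 * W + 7) = M * (4 * W + 6) + M := by ring
    rw [hpt, t3]
    simp
    omega

/-- The program for the array of all values of `ZFib`. -/
def arrayProgram : Stmt Reg :=
  prepare ;; ite one m packedArray unpackedArray

/-- A bound on the time of `arrayProgram`. -/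
def arrayTime (N : ℕ) : ℕ :=
  30 * Nat.log 2 N + 60 +
    if 2 ≤ cellDigits N then packedTime N else N * (19 * Nat.log 2 N + 40)

theorem arrayProgram_wp {N : ℕ} (hN : 1 ≤ N) :
    wp N arrayProgram ⟨fun r => if r = n then N else 0, fun _ => 0, 0⟩ fun σ =>
      IsPackedArray σ.mem (σ.reg n) (σ.reg m) (σ.reg w) N zFib ∧ σ.time ≤ arrayTime N := by
  simp only [arrayProgram, wp_seq]
  refine (prepare_wp hN).mono ?_
  rintro σ - ⟨J, hσ, ht⟩
  have hσ' : Prepared N J σ.tick := ⟨hσ.zero, hσ.one, hσ.n, hσ.L, hσ.w, hσ.m, hσ.a0, hσ.b0,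
    hσ.fib_le, hσ.lt_fib, hσ.le_log⟩
  rw [wp_ite, hσ.one, hσ.m]
  refine ⟨fun h => ?_, fun h => ?_⟩
  · refine (packedArray_wp hσ' h).mono fun σ' _ hq => ⟨hq.1, hq.2.trans ?_⟩
    rw [arrayTime, if_pos (show 2 ≤ cellDigits N from h), RamState.tick_time]; omega
  · refine (unpackedArray_wp hN hσ').mono fun σ' _ hq => ⟨hq.1, ?_⟩
    have := hq.2
    rw [arrayTime, if_neg (by omega)]
    simp at this ⊢; omega

/-! ### The asymptotic bound -/

theorem digitWidth_le {N : ℕ} : digitWidth N ≤ Nat.log 2 (Nat.log 2 N) + 2 := by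
  rw [digitWidth]
  have : Nat.clog 2 (Nat.log 2 N + 1) ≤ Nat.log 2 (Nat.log 2 N) + 1 :=
    Nat.clog_le_of_le_pow (Nat.lt_pow_succ_log_self one_lt_two (Nat.log 2 N))
  omega

theorem four_mul_digitWidth_lt {N : ℕ} (h : 64 ≤ Nat.log 2 N) :
    4 * digitWidth N < Nat.log 2 N := by
  have key : ∀ k, 4 * (k + 6) + 9 ≤ 2 ^ (k + 6) := by
    intro k
    induction k with
    | zero => norm_num
    | succ k ih =>
      have : 2 ^ (k + 1 + 6) = 2 ^ (k + 6) + 2 ^ (k + 6) := by ring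
      omega
  have h6 : 6 ≤ Nat.log 2 (Nat.log 2 N) :=
    (Nat.le_log_iff_pow_le one_lt_two (by omega)).2 (by norm_num; exact h)
  obtain ⟨k, hk⟩ := Nat.exists_eq_add_of_le' h6
  have h1 := key k
  have h2 := Nat.pow_log_le_self 2 (show Nat.log 2 N ≠ 0 by omega)
  have h3 := digitWidth_le (N := N)
  rw [hk] at h2 h3
  omega

theorem two_le_cellDigits {N : ℕ} (h : 64 ≤ Nat.log 2 N) : 2 ≤ cellDigits N := by
  have h1 := four_mul_digitWidth_lt h
  rw [cellDigits, Nat.le_div_iff_mul_le (by rw [digitWidth]; omega)]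
  omega

/-- Rounding down in `cellDigits` loses at most a factor 2, as `M + 1 ≤ 2 * M`; so `Nat.log 2 N ≤ 4
* W * M`. -/
theorem div_cellDigits_mul_log_le {N : ℕ} (h : 64 ≤ Nat.log 2 N) :
    N / cellDigits N * Nat.log 2 N ≤ 4 * digitWidth N * N := by
  have hM := two_le_cellDigits h
  have hW : 0 < 2 * digitWidth N := by rw [digitWidth]; omega
  have h1 : Nat.log 2 N - 1 < 2 * digitWidth N * (cellDigits N + 1) :=
    Nat.lt_mul_div_succ _ hW
  have h2 : 2 * digitWidth N * (cellDigits N + 1) ≤ 2 * digitWidth N * (2 * cellDigits N) :=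
    Nat.mul_le_mul_left _ (by omega)
  have h3 : Nat.log 2 N ≤ 4 * digitWidth N * cellDigits N := by
    have : 2 * digitWidth N * (2 * cellDigits N) = 4 * digitWidth N * cellDigits N := by ring
    omega
  calc N / cellDigits N * Nat.log 2 N
      ≤ N / cellDigits N * (4 * digitWidth N * cellDigits N) := Nat.mul_le_mul_left _ h3
    _ = 4 * digitWidth N * (N / cellDigits N * cellDigits N) := by ring
    _ ≤ 4 * digitWidth N * N := Nat.mul_le_mul_left _ (Nat.div_mul_le_self _ _)

theorem arrayTime_le {N : ℕ} (h : 64 ≤ Nat.log 2 N) :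
    (arrayTime N : ℝ) ≤ 816 * (N * Real.log (Real.log N) / Real.log N) +
      32000 * (√N * Real.log N ^ 3) := by
  have hN0 : N ≠ 0 := by rintro rfl; simp at h
  have hNpos : (0 : ℝ) < N := by exact_mod_cast Nat.pos_of_ne_zero hN0
  have hlog2 : (1 / 2 : ℝ) < Real.log 2 := by have := Real.log_two_gt_d9; linarith
  have hlog2' : Real.log 2 < 1 := by have := Real.log_two_lt_d9; linarith
  have hl64 : (64 : ℝ) ≤ Nat.log 2 N := by exact_mod_cast h
  have hup : ∀ k : ℕ, (Nat.log 2 k : ℝ) ≤ 2 * Real.log k := by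
    intro k
    have h1 := Real.natLog_le_logb k 2
    rw [Real.logb, Nat.cast_ofNat, le_div_iff₀ (by linarith)] at h1
    have : (0 : ℝ) ≤ Nat.log 2 k := Nat.cast_nonneg _
    nlinarith
  have hl1 := hup N
  have hL32 : (32 : ℝ) ≤ Real.log N := by linarith
  have hl2 : Real.log N ≤ 2 * Nat.log 2 N := by
    have h1 : (N : ℝ) ≤ 2 ^ (Nat.log 2 N + 1) := by
      exact_mod_cast (Nat.lt_pow_succ_log_self one_lt_two N).le
    have h2 := Real.log_le_log hNpos h1
    rw [Real.log_pow] at h2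
    push_cast at h2
    nlinarith
  have hLL : 1 ≤ Real.log (Real.log N) := by
    rw [Real.le_log_iff_exp_le (by linarith)]
    have := Real.exp_one_lt_d9
    linarith
  have hW : (digitWidth N : ℝ) ≤ 6 * Real.log (Real.log N) := by
    have h1 : (digitWidth N : ℝ) ≤ Nat.log 2 (Nat.log 2 N) + 2 := by
      exact_mod_cast digitWidth_le
    have h2 := hup (Nat.log 2 N)
    have h3 : Real.log (Nat.log 2 N) ≤ Real.log (2 * Real.log N) :=
      Real.log_le_log (by linarith) hl1
    rw [Real.log_mul (by norm_num) (by linarith)] at h3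
    linarith
  -- Here 48 = 4 · 6 · 2, from `4 * digitWidth N`, from `hW`, and from the change to the natural
  -- logarithm. With 17 units per cell it yields 816.
  have hdiv : ((N / cellDigits N : ℕ) : ℝ) ≤ 48 * (N * Real.log (Real.log N) / Real.log N) := by
    have h1 : ((N / cellDigits N : ℕ) : ℝ) * Nat.log 2 N ≤ 4 * digitWidth N * N := by
      exact_mod_cast div_cellDigits_mul_log_le h
    have h2 : (0 : ℝ) ≤ ((N / cellDigits N : ℕ) : ℝ) := Nat.cast_nonneg _
    rw [mul_div_assoc', le_div_iff₀ (by linarith)]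
    nlinarith
  have hC : ((2 ^ digitWidth N) ^ cellDigits N : ℝ) ≤ √N := by
    refine Real.le_sqrt_of_sq_le ?_
    have h1 := cell_mul_self_le (two_le_cellDigits h)
    have h2 : ((2 ^ digitWidth N) ^ cellDigits N) ^ 2 ≤ N := by rw [sq]; omega
    exact_mod_cast h2
  have hs : (1 : ℝ) ≤ √N := by
    rw [Real.one_le_sqrt]
    exact_mod_cast Nat.pos_of_ne_zero hN0
  have hrest : (11 * (2 ^ digitWidth N) ^ cellDigits N + 70 * (Nat.log 2 N + 1) ^ 2 : ℝ) *
      (2 * Nat.log 2 N + 5) + 30 * Nat.log 2 N + 60 ≤ 32000 * (√N * Real.log N ^ 3) := by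
    set s := √(N : ℝ)
    set l := (Nat.log 2 N : ℝ)
    set y := Real.log N
    have hsq : l + 1 ≤ (l + 1) ^ 2 := by nlinarith
    have a1 : (11 * (2 ^ digitWidth N) ^ cellDigits N + 70 * (l + 1) ^ 2 : ℝ) ≤
        81 * (s * (l + 1) ^ 2) := by nlinarith
    have hl0 : 0 ≤ l := by linarith
    have a2 : (11 * (2 ^ digitWidth N) ^ cellDigits N + 70 * (l + 1) ^ 2 : ℝ) * (2 * l + 5) ≤
        81 * (s * (l + 1) ^ 2) * (5 * (l + 1)) :=
      mul_le_mul a1 (by linarith) (by linarith) (by positivity)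
    have a3 : 30 * l + 60 ≤ 60 * (s * (l + 1) ^ 3) := by
      have : l + 1 ≤ (l + 1) ^ 3 := by nlinarith
      nlinarith
    have a4 : (l + 1) ^ 3 ≤ (3 * y) ^ 3 := pow_le_pow_left₀ (by linarith) (by linarith) 3
    have a5 : s * (l + 1) ^ 3 ≤ s * (3 * y) ^ 3 := mul_le_mul_of_nonneg_left a4 (by linarith)
    have a6 : 0 ≤ s * y ^ 3 := by positivity
    nlinarith
  rw [arrayTime, if_pos (two_le_cellDigits h), packedTime]
  push_cast at hdiv ⊢
  linarith

theorem isBigO_arrayTime : (fun n : ℕ => (arrayTime n : ℝ)) =O[atTop]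
    fun n : ℕ => (n : ℝ) * Real.log (Real.log n) / Real.log n := by
  have hlit := ((isLittleO_log_rpow_rpow_atTop (4 : ℝ) (show (0 : ℝ) < 1 / 2 by norm_num)).bound
    one_pos)
  have hnat := tendsto_natCast_atTop_atTop (R := ℝ) |>.eventually hlit
  refine IsBigO.of_bound 32816 ?_
  filter_upwards [hnat, eventually_ge_atTop (2 ^ 64)] with N h1 h2
  have hl : 64 ≤ Nat.log 2 N := (Nat.le_log_iff_pow_le one_lt_two (by omega)).2 h2
  have h3 := arrayTime_le hl
  have hNpos : (0 : ℝ) < N := by exact_mod_cast (show 0 < N by omega)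
  have hexp : Real.exp 3 ≤ N := by
    have e1 : Real.exp 3 = Real.exp 1 ^ 3 := by rw [← Real.exp_nat_mul]; norm_num
    have e2 : Real.exp 1 ^ 3 ≤ 3 ^ 3 :=
      pow_le_pow_left₀ (Real.exp_pos _).le (by have := Real.exp_one_lt_d9; linarith) 3
    have e3 : ((2 ^ 64 : ℕ) : ℝ) ≤ N := by exact_mod_cast h2
    push_cast at e3
    rw [e1]; linarith
  have hL : 3 ≤ Real.log N := (Real.le_log_iff_exp_le hNpos).2 hexp
  have hLL : 1 ≤ Real.log (Real.log N) := by
    rw [Real.le_log_iff_exp_le (by linarith)]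
    have := Real.exp_one_lt_d9
    linarith
  -- This makes the term √N · log³ N of the table rebuilding at most N / log N.
  have hL4 : Real.log N ^ 4 ≤ √N := by
    rw [one_mul, Real.norm_of_nonneg (by positivity), Real.norm_of_nonneg (by positivity),
      ← Real.sqrt_eq_rpow] at h1
    exact_mod_cast h1
  have hs : √(N : ℝ) * √N = N := Real.mul_self_sqrt hNpos.le
  have h4 : √N * Real.log N ^ 3 ≤ N * Real.log (Real.log N) / Real.log N := by
    rw [le_div_iff₀ (by linarith)]
    calc √N * Real.log N ^ 3 * Real.log N = √N * Real.log N ^ 4 := by ring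
      _ ≤ √N * √N := mul_le_mul_of_nonneg_left hL4 (Real.sqrt_nonneg _)
      _ = N * 1 := by rw [hs, mul_one]
      _ ≤ N * Real.log (Real.log N) := mul_le_mul_of_nonneg_left hLL hNpos.le
  rw [Real.norm_of_nonneg (Nat.cast_nonneg _), Real.norm_of_nonneg (by positivity)]
  linarith

theorem mainTheorem8 :
    -- (1) the value `ZFib[n]` in time and space `O(log n)`
    (∃ (k : ℕ) (P : Program (k + 1)) (T S : ℕ → ℕ),
      (fun n : ℕ => (T n : ℝ)) =O[Filter.atTop] (fun n : ℕ => Real.log n) ∧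
      (fun n : ℕ => (S n : ℝ)) =O[Filter.atTop] (fun n : ℕ => Real.log n) ∧
      ∀ n : ℕ, 1 ≤ n → ∃ (t : ℕ) (c : Config (k + 1)),
        P.HaltsAfter n (Config.init (k + 1) n) t c ∧
        c.reg 0 = zFib n ∧
        t ≤ T n ∧
        ∀ s ≤ t, ∀ c' : Config (k + 1),
          P.run n s (Config.init (k + 1) n) = some c' → c'.space ≤ S n) ∧
    -- (2) the packed array `ZFib[1], …, ZFib[n]` in time `O(n log log n / log n)`
    (∃ (k : ℕ) (P : Program (k + 3)) (T : ℕ → ℕ),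
      (fun n : ℕ => (T n : ℝ)) =O[Filter.atTop]
        (fun n : ℕ => (n : ℝ) * Real.log (Real.log n) / Real.log n) ∧
      ∀ n : ℕ, 1 ≤ n → ∃ (t : ℕ) (c : Config (k + 3)),
        P.HaltsAfter n (Config.init (k + 3) n) t c ∧
        IsPackedArray c.mem (c.reg 0) (c.reg 1) (c.reg 2) n zFib ∧
        t ≤ T n) := by
  refine ⟨zFib_single_value, 30, arrayProgram.compile Reg.toFin 0, arrayTime, isBigO_arrayTime,
    fun N hN => ?_⟩
  obtain ⟨t, c, σ, h1, ⟨h2, h3⟩, h4, h5, h6⟩ :=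
    wp.haltsAfter Reg.toFin_injective (r₀ := Reg.n) rfl (arrayProgram_wp hN)
  refine ⟨t, c, h1, ?_, h4.trans_le h3⟩
  -- The output registers are the first three constructors of `Reg`; at the end `n` holds the base
  -- address.
  rw [h6, show c.reg 0 = σ.reg Reg.n from h5 Reg.n, show c.reg 1 = σ.reg Reg.m from h5 Reg.m,
    show c.reg 2 = σ.reg Reg.w from h5 Reg.w]
  exact h2
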